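/- For $a\in[0,1]$, $\gamma\in\mathbb C\setminus\{0\}$ and a complex-valued $q\in L_2(0,1)$, let $\mathcal L(q,a,\gamma)$ denote the boundary value problem $$-y''(x)+q(x)y(a)=\lambda y(x),\quad 0<x<1,\qquad y(0)=\gamma y(1),\quad y'(0)=\gamma y'(1),$$ with solutions $y\in W_2^2[0,1]$. Its spectrum is the sequence $\{\lambda_n\}_{n\ge0}$ of all its eigenvalues, each repeated according to its multiplicity as a zero of the characteristic function $$\Delta(\lambda)=\begin{vmatrix} C(0,\lambda)-\gamma C(1,\lambda) & S(0,\lambda)-\gamma S(1,\lambda)\\ C'(0,\lambda)-\gamma C'(1,\lambda) & S'(0,\lambda)-\gamma S'(1,\lambda)\end{vmatrix},$$ where $C(x,\lambda)$, $S(x,\lambda)$ are the solutions of the equation with $C(a,\lambda)=S'(a,\lambda)=1$, $S(a,\lambda)=C'(a,\lambda)=0$. Let $$\alpha=\frac1\pi\arccos\frac{1+\gamma^2}{2\gamma}\in\{z:\ 0\le\operatorname{Re}z\le1,\ \operatorname{Im}z\ge0\}\cup\{z:\ 0<\operatorname{Re}z<1,\ \operatorname{Im}z<0\}$$ (this determines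 $\alpha$ uniquely). A complex sequence $\{\lambda_n\}_{n\ge0}$ is said to have the form $(*)$ if $$\lambda_{2k}=(2k+\alpha)^2\pi^2+\varkappa_{2k},\ k\ge0,\qquad \lambda_{2k-1}=(2k-\alpha)^2\pi^2+\varkappa_{2k-1},\ k\ge1,\qquad \{\varkappa_n\}_{n\ge0}\in l_2.$$ **Theorem 3.** Let $\gamma\in\mathbb C\setminus\{0,1,-1\}$. Then for any fixed $a\in[0,1]$ and any complex sequence $\{\lambda_n\}_{n\ge0}$ of the form $(*)$, there exists a unique function $q\in L_2(0,1)$ (up to equality almost everywhere) such that $\{\lambda_n\}_{n\ge0}$ is the spectrum of $\mathcal L(q,a,\gamma)$. Let $\gamma\in\{-1,1\}$. Then for any fixed $a\in[0,1]$ and any complex sequence $\{\lambda_n\}_{n\ge0}$ of the form $(*)$ with $\varkappa_{2k-1}=0$ for all $k\ge1$, there exists $q\in L_2(0,1)$ such that $\{\lambda_n\}_{n\ge0}$ is the spectrum of $\mathcal L(q,a,\gamma)$, and such a $q$ is not unique: at least two functions in $L_2(0,1)$ that differ on a set of positive measure have this property. -/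

import Mathlib

open MeasureTheory

noncomputable section

namespace FrozenHill

/-- Lebesgue measure on the interval `(0,1)`. -/
abbrev unitMeasure : Measure ℝ := volume.restrict (Set.Ioo (0 : ℝ) 1)

/-- The space `L₂(0,1)` of complex-valued functions (classes modulo equality a.e.). -/
abbrev L2 : Type := Lp ℂ 2 unitMeasure

/-- The derivative on `[0,1]` (one-sided at the end points) of a function `y : [0,1] → ℂ`.
Functions on `[0,1]` are represented by functions on `ℝ`; the values outside `[0,1]` are never
used. -/
def D (y : ℝ → ℂ) : ℝ → ℂ := derivWithin y (Set.Icc (0 : ℝ) 1)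

/-- The Sobolev space `W₂²[0,1]`: `y` is differentiable on `[0,1]`, `y'` is absolutely continuous
on `[0,1]`, and `y''` (which then exists a.e.) belongs to `L₂(0,1)`. -/
structure IsW22 (y : ℝ → ℂ) : Prop where
  differentiableOn : DifferentiableOn ℝ y (Set.Icc (0 : ℝ) 1)
  absolutelyContinuous : AbsolutelyContinuousOnInterval (D y) 0 1
  memLp : MemLp (D (D y)) 2 unitMeasure

/-- `y ∈ W₂²[0,1]` is a solution of `-y''(x) + q(x) y(a) = μ y(x)`, `0 < x < 1`. -/
structure IsSolution (q : L2) (a : ℝ) (μ : ℂ) (y : ℝ → ℂ) : Prop where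
  isW22 : IsW22 y
  equation : ∀ᵐ x ∂unitMeasure, -D (D y) x + q x * y a = μ * y x

/-- `μ` is an eigenvalue of the boundary value problem `L(q,a,γ)`:
`-y''(x) + q(x) y(a) = μ y(x)`, `0 < x < 1`, `y(0) = γ y(1)`, `y'(0) = γ y'(1)`. -/
def IsEigenvalue (q : L2) (a : ℝ) (γ μ : ℂ) : Prop :=
  ∃ y : ℝ → ℂ, IsSolution q a μ y ∧ y 0 = γ * y 1 ∧ D y 0 = γ * D y 1 ∧
    ∃ x ∈ Set.Icc (0 : ℝ) 1, y x ≠ 0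

/-- `Δ` is the characteristic function of `L(q,a,γ)`: for every `μ`, `Δ μ` is the determinant of
the boundary conditions evaluated on the solutions `C`, `S` of the equation with
`C(a) = S'(a) = 1`, `S(a) = C'(a) = 0`. -/
def IsCharFunction (q : L2) (a : ℝ) (γ : ℂ) (Δ : ℂ → ℂ) : Prop :=
  ∀ μ : ℂ, ∃ C S : ℝ → ℂ, IsSolution q a μ C ∧ IsSolution q a μ S ∧
    C a = 1 ∧ D C a = 0 ∧ S a = 0 ∧ D S a = 1 ∧
    Δ μ = Matrix.det !![C 0 - γ * C 1, S 0 - γ * S 1;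
                        D C 0 - γ * D C 1, D S 0 - γ * D S 1]

/-- The sequence `lam` is the spectrum of `L(q,a,γ)`: its values are exactly the eigenvalues, and
every eigenvalue occurs in it as often as its multiplicity says, i.e. its order as a zero of the
characteristic function. -/
def IsSpectrum (q : L2) (a : ℝ) (γ : ℂ) (lam : ℕ → ℂ) : Prop :=
  (∀ μ : ℂ, (∃ n, lam n = μ) ↔ IsEigenvalue q a γ μ) ∧
  ∃ Δ : ℂ → ℂ, IsCharFunction q a γ Δ ∧
    ∀ n, {m : ℕ | lam m = lam n}.encard = analyticOrderAt Δ (lam n)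

/-- `α = π⁻¹ arccos((1 + γ²)/(2γ))`, with the branch of `arccos` whose values, divided by `π`, lie
in `{0 ≤ Re z ≤ 1, Im z ≥ 0} ∪ {0 < Re z < 1, Im z < 0}`; this set contains exactly one such `α`
for every `γ ≠ 0`. -/
def IsShift (γ α : ℂ) : Prop :=
  Complex.cos (Real.pi * α) = (1 + γ ^ 2) / (2 * γ) ∧
  ((0 ≤ α.re ∧ α.re ≤ 1 ∧ 0 ≤ α.im) ∨ (0 < α.re ∧ α.re < 1 ∧ α.im < 0))

/-- `lam (2k) = (2k + α)²π² + κ (2k)` for `k ≥ 0` and `lam (2k-1) = (2k - α)²π² + κ (2k-1)` for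
`k ≥ 1`, where `κ` is square-summable. -/
def HasAsymptotics (α : ℂ) (lam κ : ℕ → ℂ) : Prop :=
  (∀ k : ℕ, lam (2 * k) = (2 * k + α) ^ 2 * Real.pi ^ 2 + κ (2 * k)) ∧
  (∀ k : ℕ, 1 ≤ k → lam (2 * k - 1) = (2 * k - α) ^ 2 * Real.pi ^ 2 + κ (2 * k - 1)) ∧
  Memℓp κ 2

end FrozenHill

end

open MeasureTheory

noncomputable section

namespace FrozenHill

open Set Filter Topology

/-! Put `λ = ρ²`. Variation of constants expresses every solution through its Cauchy data at `a`, so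
the eigenvalues are the zeros of a determinant which is affine in `q`. Reflecting the two pieces of
`q` around `a` turns `q` into a function `X` on `(0,1)`, bijectively because `γ ≠ 0`, and removes
`a` from the problem: `Δ(ρ²) = 1 + γ² - 2γ cos ρ - ∫ W(u) sin(ρu)/ρ du`, where `W = X + γRX` and
`RX(u) = X(1 - u)` (`charDet_eq`, `integral_fold`). Two questions remain: which zeros can be
produced by a choice of `W`, and whether `W` determines `X`.

Zeros. The unperturbed function `Δ₀ = 2γ(cos πα - cos ρ)` vanishes at the squares `lₖ` of the nodes
`π(2k + α)`, `k ∈ ℤ`, and `Δ₀ ∏ (1 - κₖ/(λ - lₖ))` has the prescribed zeros. The partial fraction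
residues `bₖ` of the product are bounded by a constant times `|κₖ|`, hence square-summable. The
cosine takes the same value `cos πα` at all nodes, so `Δ₀ bₖ/(λ - lₖ)` is the sine transform of a
multiple of `cos(π(2k + α)(1 - u))`, and these functions sum in `L₂`
(`exists_sinTransform_of_zeros`). The bound on the residues needs the nodes that really move to be
separated. For `γ ≠ ±1` this holds because `α` is not an integer. For `γ = ±1` the values `lₖ`
coincide in pairs, and `κ_{2k-1} = 0` lets at most one member of each pair move.

Uniqueness. The quotient of two characteristic functions with the same zeros is entire and bounded,
hence constant, and it tends to `1` along the imaginary axis (`eq_of_analyticOrderAt_eq`). The sine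
transform is injective, so `W` is determined. Since `R² = 1`, the map `1 + γR` is invertible
precisely when `γ² ≠ 1`. For `γ = ±1` the constructed `W` satisfies `RW = γW`, so `X = W/2` is a
solution, and adding an element of the kernel of `1 + γR` gives another one. -/

/-! ### Absolutely continuous complex-valued functions -/

theorem absolutelyContinuousOnInterval_of_dist_le {X Y : Type*} [PseudoMetricSpace X]
    [PseudoMetricSpace Y] {f : ℝ → X} {g : ℝ → Y} {a b : ℝ}
    (hf : AbsolutelyContinuousOnInterval f a b)
    (h : ∀ x ∈ uIcc a b, ∀ y ∈ uIcc a b, dist (g x) (g y) ≤ dist (f x) (f y)) :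
    AbsolutelyContinuousOnInterval g a b := by
  rw [absolutelyContinuousOnInterval_iff] at hf ⊢
  intro ε hε
  obtain ⟨δ, hδ, H⟩ := hf ε hε
  refine ⟨δ, hδ, fun E hE hs => lt_of_le_of_lt (Finset.sum_le_sum fun i hi => ?_) (H E hE hs)⟩
  exact h _ (hE.1 i hi).1 _ (hE.1 i hi).2

theorem absolutelyContinuousOnInterval_congr {X : Type*} [PseudoMetricSpace X]
    {f g : ℝ → X} {a b : ℝ} (hf : AbsolutelyContinuousOnInterval f a b)
    (h : EqOn g f (uIcc a b)) : AbsolutelyContinuousOnInterval g a b :=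
  absolutelyContinuousOnInterval_of_dist_le hf fun x hx y hy => by rw [h hx, h hy]

/-- The increments of `∫ f` are dominated by those of the real integral `∫ ‖f‖`, which is absolutely
continuous. -/
theorem absolutelyContinuousOnInterval_integral {f : ℝ → ℂ} {a b c : ℝ}
    (hf : IntervalIntegrable f volume a b) (hc : c ∈ uIcc a b) :
    AbsolutelyContinuousOnInterval (fun x => ∫ t in c..x, f t) a b := by
  have hsub : ∀ x ∈ uIcc a b, IntervalIntegrable f volume c x := fun x hx =>
    hf.mono_set (uIcc_subset_uIcc hc hx)
  refine absolutelyContinuousOnInterval_of_dist_le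
    (hf.norm.absolutelyContinuousOnInterval_intervalIntegral hc) fun x hx y hy => ?_
  rw [dist_comm, dist_comm (∫ t in c..x, ‖f t‖), dist_eq_norm, Real.dist_eq,
    intervalIntegral.integral_interval_sub_left (hsub y hy) (hsub x hx),
    intervalIntegral.integral_interval_sub_left (hsub y hy).norm (hsub x hx).norm]
  exact intervalIntegral.norm_integral_le_abs_integral_norm

/-- The difference of `f` and the integral of `g` is absolutely continuous with derivative zero
almost everywhere, hence constant. The end points, where nothing is assumed, form a null set. -/
theorem eq_add_integral_of_absolutelyContinuous {f g : ℝ → ℂ} {a x : ℝ}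
    (ha : a ∈ Icc (0 : ℝ) 1) (hx : x ∈ Icc (0 : ℝ) 1)
    (hf : AbsolutelyContinuousOnInterval f 0 1) (hg : IntervalIntegrable g volume 0 1)
    (h : ∀ᵐ t ∂unitMeasure, HasDerivAt f (g t) t) :
    f x = f a + ∫ t in a..x, g t := by
  have hu : uIcc (0 : ℝ) 1 = Icc 0 1 := uIcc_of_le zero_le_one
  have hac := hf.sub (absolutelyContinuousOnInterval_integral hg (hu ▸ ha))
  obtain ⟨C, hC⟩ := hac.const_of_ae_hasDerivAt_zero (by
    rw [ae_restrict_iff' measurableSet_Ioo] at h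
    have h0 : ∀ᵐ t : ℝ, t ≠ 0 := by simp [ae_iff, measure_singleton]
    have h1 : ∀ᵐ t : ℝ, t ≠ 1 := by simp [ae_iff, measure_singleton]
    filter_upwards [h, hg.ae_hasDerivAt_integral, h0, h1] with t ht ht' h0 h1 hm
    rw [hu] at hm
    have := (ht ⟨lt_of_le_of_ne hm.1 h0.symm, lt_of_le_of_ne hm.2 h1⟩).sub
      (ht' (hu ▸ hm) a (hu ▸ ha))
    simpa using this)
  have h1 := hC x (hu ▸ hx)
  have h2 := hC a (hu ▸ ha)
  simp only [Pi.sub_apply, intervalIntegral.integral_same, sub_zero] at h1 h2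
  rw [h2, ← h1]; ring

theorem ae_hasDerivAt_of_absolutelyContinuous {f : ℝ → ℂ}
    (hf : AbsolutelyContinuousOnInterval f 0 1) :
    ∀ᵐ t ∂unitMeasure, HasDerivAt f (D f t) t := by
  rw [ae_restrict_iff' measurableSet_Ioo]
  filter_upwards [hf.boundedVariationOn.ae_differentiableAt_of_mem_uIcc] with t ht hm
  have := ht (by rw [uIcc_of_le zero_le_one]; exact Ioo_subset_Icc_self hm)
  rw [D, this.derivWithin (uniqueDiffOn_Icc zero_lt_one _ (Ioo_subset_Icc_self hm))]
  exact this.hasDerivAt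

theorem intervalIntegrable_of_memLp_two {q : ℝ → ℂ} (hq : MemLp q 2 unitMeasure) :
    IntervalIntegrable q volume 0 1 := by
  rw [intervalIntegrable_iff_integrableOn_Ioo_of_le zero_le_one]
  exact hq.integrable one_le_two

theorem memLp_of_continuousOn {f : ℝ → ℂ} (hf : ContinuousOn f (Icc 0 1)) :
    MemLp f 2 unitMeasure := by
  obtain ⟨C, hC⟩ := isCompact_Icc.exists_bound_of_continuousOn hf
  refine MemLp.of_bound ((hf.mono Ioo_subset_Icc_self).aestronglyMeasurable measurableSet_Ioo) C ?_
  filter_upwards [ae_restrict_mem measurableSet_Ioo] with x hx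
  exact hC x (Ioo_subset_Icc_self hx)

/-! ### The kernels `cos (ρ z)` and `sin (ρ z) / ρ` -/

/-- The function `sin (ρ z) / ρ`, extended by `z` at `ρ = 0`. -/
def sinOver (ρ z : ℂ) : ℂ := if ρ = 0 then z else Complex.sin (ρ * z) / ρ

theorem mul_sinOver (ρ z : ℂ) : ρ * sinOver ρ z = Complex.sin (ρ * z) := by
  unfold sinOver; split_ifs with h
  · simp [h]
  · field_simp

theorem hasDerivAt_sinOver (ρ z : ℂ) : HasDerivAt (sinOver ρ) (Complex.cos (ρ * z)) z := by
  by_cases h : ρ = 0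
  · have : sinOver ρ = id := by funext w; simp [sinOver, h]
    rw [this]; simpa [h] using hasDerivAt_id z
  · have : sinOver ρ = fun w => Complex.sin (ρ * w) / ρ := by funext w; simp [sinOver, h]
    rw [this]
    have := (((hasDerivAt_id z).const_mul ρ).csin).div_const ρ
    simpa [h] using this

theorem hasDerivAt_cos_mul (ρ z : ℂ) :
    HasDerivAt (fun w => Complex.cos (ρ * w)) (-ρ ^ 2 * sinOver ρ z) z := by
  have := ((hasDerivAt_id z).const_mul ρ).ccos
  have h := mul_sinOver ρ z
  refine this.congr_deriv ?_
  change -Complex.sin (ρ * z) * (ρ * 1) = _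
  linear_combination ρ * h

@[simp] theorem sinOver_zero (ρ : ℂ) : sinOver ρ 0 = 0 := by simp [sinOver]

theorem sinOver_neg (ρ z : ℂ) : sinOver ρ (-z) = -sinOver ρ z := by
  unfold sinOver; split_ifs <;> simp [neg_div]

theorem sinOver_add (ρ z w : ℂ) : sinOver ρ (z + w) =
    sinOver ρ z * Complex.cos (ρ * w) + Complex.cos (ρ * z) * sinOver ρ w := by
  unfold sinOver; split_ifs with h
  · simp [h]
  · rw [mul_add, Complex.sin_add]; ring

theorem sinOver_sub (ρ z w : ℂ) : sinOver ρ (z - w) =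
    sinOver ρ z * Complex.cos (ρ * w) - Complex.cos (ρ * z) * sinOver ρ w := by
  rw [sub_eq_add_neg, sinOver_add, sinOver_neg, mul_neg, Complex.cos_neg]; ring

theorem cos_mul_add (ρ z w : ℂ) : Complex.cos (ρ * (z + w)) =
    Complex.cos (ρ * z) * Complex.cos (ρ * w) - ρ ^ 2 * sinOver ρ z * sinOver ρ w := by
  rw [mul_add, Complex.cos_add, ← mul_sinOver, ← mul_sinOver]; ring

theorem cos_mul_sub (ρ z w : ℂ) : Complex.cos (ρ * (z - w)) =
    Complex.cos (ρ * z) * Complex.cos (ρ * w) + ρ ^ 2 * sinOver ρ z * sinOver ρ w := by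
  rw [mul_sub, Complex.cos_sub, ← mul_sinOver, ← mul_sinOver]; ring

theorem cos_sq_add_sinOver_sq (ρ z : ℂ) :
    Complex.cos (ρ * z) ^ 2 + ρ ^ 2 * sinOver ρ z ^ 2 = 1 := by
  rw [← mul_pow, mul_sinOver]; rw [add_comm]; exact Complex.sin_sq_add_cos_sq _

theorem differentiable_sinOver (ρ : ℂ) : Differentiable ℂ (sinOver ρ) :=
  fun z => (hasDerivAt_sinOver ρ z).differentiableAt

@[fun_prop]
theorem continuous_sinOver (ρ : ℂ) : Continuous (sinOver ρ) := (differentiable_sinOver ρ).continuous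

theorem contDiff_sinOver (ρ : ℂ) {n : WithTop ℕ∞} : ContDiff ℝ n (fun t : ℝ => sinOver ρ t) :=
  ((differentiable_sinOver ρ).contDiff.restrict_scalars ℝ).comp Complex.ofRealCLM.contDiff

theorem contDiff_cos_mul (ρ : ℂ) {n : WithTop ℕ∞} :
    ContDiff ℝ n (fun t : ℝ => Complex.cos (ρ * t)) := by
  have : Differentiable ℂ (fun w : ℂ => Complex.cos (ρ * w)) := by fun_prop
  exact (this.contDiff.restrict_scalars ℝ).comp Complex.ofRealCLM.contDiff

theorem unitMeasure_ae_of_forall {p : ℝ → Prop} (h : ∀ x ∈ Ioo (0 : ℝ) 1, p x) :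
    ∀ᵐ x ∂unitMeasure, p x := by
  filter_upwards [ae_restrict_mem measurableSet_Ioo] with x hx using h x hx

theorem hasDerivAt_D {y : ℝ → ℂ} (hy : DifferentiableOn ℝ y (Icc 0 1)) {x : ℝ}
    (hx : x ∈ Ioo (0 : ℝ) 1) : HasDerivAt y (D y x) x :=
  ((hy x (Ioo_subset_Icc_self hx)).hasDerivWithinAt).hasDerivAt (Icc_mem_nhds hx.1 hx.2)

theorem IsW22.absolutelyContinuous_self {y : ℝ → ℂ} (hy : IsW22 y) :
    AbsolutelyContinuousOnInterval y 0 1 := by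
  apply ContDiffOn.absolutelyContinuousOnInterval
  rw [uIcc_of_le zero_le_one, show (1 : WithTop ℕ∞) = 0 + 1 by simp,
    contDiffOn_succ_iff_derivWithin (uniqueDiffOn_Icc zero_lt_one)]
  refine ⟨hy.1, by simp, contDiffOn_zero.2 ?_⟩
  have := hy.2.continuousOn
  rwa [uIcc_of_le zero_le_one] at this

theorem intervalIntegrable_mul_kernel {q : ℝ → ℂ} (hq : IntervalIntegrable q volume 0 1)
    {a x : ℝ} (ha : a ∈ Icc (0 : ℝ) 1) (hx : x ∈ Icc (0 : ℝ) 1) {f : ℝ → ℂ} (hf : Continuous f) :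
    IntervalIntegrable (fun t => f t * q t) volume a x := by
  refine (hq.mono_set ?_).continuousOn_mul hf.continuousOn
  rw [uIcc_of_le zero_le_one]
  exact uIcc_subset_Icc ha hx

theorem hasDerivAt_sinOver_sub (ρ : ℂ) (x t : ℝ) :
    HasDerivAt (fun t : ℝ => sinOver ρ (x - t)) (-Complex.cos (ρ * (x - t))) t := by
  have h := (hasDerivAt_sinOver ρ (x - t)).comp_of_eq (t : ℂ) ((hasDerivAt_id (t : ℂ)).const_sub (x : ℂ)) rfl
  simpa using h.comp_ofReal

theorem hasDerivAt_cos_sub (ρ : ℂ) (x t : ℝ) :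
    HasDerivAt (fun t : ℝ => Complex.cos (ρ * (x - t))) (ρ ^ 2 * sinOver ρ (x - t)) t := by
  have h := (hasDerivAt_cos_mul ρ (x - t)).comp_of_eq (t : ℂ) ((hasDerivAt_id (t : ℂ)).const_sub (x : ℂ)) rfl
  simpa using h.comp_ofReal

theorem contDiff_sinOver_sub (ρ : ℂ) (x : ℝ) {n : WithTop ℕ∞} :
    ContDiff ℝ n (fun t : ℝ => sinOver ρ (x - t)) := by
  have := (contDiff_sinOver ρ (n := n)).comp (contDiff_const.sub contDiff_id : ContDiff ℝ n fun t : ℝ => x - t)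
  simpa [Function.comp_def] using this

theorem contDiff_cos_sub (ρ : ℂ) (x : ℝ) {n : WithTop ℕ∞} :
    ContDiff ℝ n (fun t : ℝ => Complex.cos (ρ * (x - t))) := by
  have := (contDiff_cos_mul ρ (n := n)).comp (contDiff_const.sub contDiff_id : ContDiff ℝ n fun t : ℝ => x - t)
  simpa [Function.comp_def] using this

theorem acOn_of_contDiff {f : ℝ → ℂ} (hf : ContDiff ℝ 1 f) : AbsolutelyContinuousOnInterval f 0 1 :=
  hf.contDiffOn.absolutelyContinuousOnInterval

/-! ### Variation of constants -/

/-- The value part of the Duhamel term. -/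
def duhamel (q : ℝ → ℂ) (a : ℝ) (ρ : ℂ) (x : ℝ) : ℂ := ∫ t in a..x, sinOver ρ (x - t) * q t

/-- The derivative part of the Duhamel term. -/
def duhamelDeriv (q : ℝ → ℂ) (a : ℝ) (ρ : ℂ) (x : ℝ) : ℂ :=
  ∫ t in a..x, Complex.cos (ρ * (x - t)) * q t

section Representation

variable {q : L2} {a : ℝ} {ρ : ℂ} {y : ℝ → ℂ}

theorem intervalIntegrable_L2 (q : L2) : IntervalIntegrable q volume 0 1 :=
  intervalIntegrable_of_memLp_two (Lp.memLp q)

/-- For fixed `x`, the function `t ↦ y'(t) sin(ρ(x - t))/ρ + y(t) cos(ρ(x - t))` equals `y x` at `t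
= x`, and by the equation its derivative is `y(a) q(t) sin(ρ(x - t))/ρ` almost everywhere.
Integration from `a` to `x` gives the formula. -/
theorem IsSolution.apply_eq (hy : IsSolution q a (ρ ^ 2) y) (ha : a ∈ Icc (0 : ℝ) 1) {x : ℝ}
    (hx : x ∈ Icc (0 : ℝ) 1) :
    y x = y a * Complex.cos (ρ * (x - a)) + D y a * sinOver ρ (x - a) + y a * duhamel q a ρ x := by
  have hac : AbsolutelyContinuousOnInterval
      (fun t => D y t * sinOver ρ (x - t) + y t * Complex.cos (ρ * (x - t))) 0 1 :=
    (hy.1.2.smul (acOn_of_contDiff (contDiff_sinOver_sub ρ x))).add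
      (hy.1.absolutelyContinuous_self.smul (acOn_of_contDiff (contDiff_cos_sub ρ x)))
  have key := eq_add_integral_of_absolutelyContinuous ha hx hac
    (g := fun t => y a * (sinOver ρ (x - t) * q t))
    ((intervalIntegrable_mul_kernel (intervalIntegrable_L2 q) (by simp) (by simp)
      (contDiff_sinOver_sub ρ x (n := 0)).continuous).const_mul _) (by
    filter_upwards [ae_hasDerivAt_of_absolutelyContinuous hy.1.2, hy.2,
      unitMeasure_ae_of_forall fun t ht => hasDerivAt_D hy.1.1 ht] with t h1 h2 h3
    have := (h1.mul (hasDerivAt_sinOver_sub ρ x t)).add (h3.mul (hasDerivAt_cos_sub ρ x t))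
    refine this.congr_deriv ?_
    linear_combination -sinOver ρ (x - t) * h2)
  rw [intervalIntegral.integral_const_mul] at key
  simp only [sub_self, sinOver_zero, mul_zero, Complex.cos_zero] at key
  rw [duhamel]
  linear_combination key

/-- Same argument with the `x`-derivative of the previous kernel. Solutions are only twice
differentiable almost everywhere, so integrating again avoids differentiating the Duhamel integral.
-/
theorem IsSolution.deriv_eq (hy : IsSolution q a (ρ ^ 2) y) (ha : a ∈ Icc (0 : ℝ) 1) {x : ℝ}
    (hx : x ∈ Icc (0 : ℝ) 1) :
    D y x = -ρ ^ 2 * y a * sinOver ρ (x - a) + D y a * Complex.cos (ρ * (x - a)) +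
      y a * duhamelDeriv q a ρ x := by
  have hac : AbsolutelyContinuousOnInterval
      (fun t => D y t * Complex.cos (ρ * (x - t)) + (-ρ ^ 2) • (y t * sinOver ρ (x - t))) 0 1 :=
    (hy.1.2.smul (acOn_of_contDiff (contDiff_cos_sub ρ x))).add
      ((hy.1.absolutelyContinuous_self.smul (acOn_of_contDiff (contDiff_sinOver_sub ρ x))).const_smul _)
  have key := eq_add_integral_of_absolutelyContinuous ha hx hac
    (g := fun t => y a * (Complex.cos (ρ * (x - t)) * q t))
    ((intervalIntegrable_mul_kernel (intervalIntegrable_L2 q) (by simp) (by simp)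
      (contDiff_cos_sub ρ x (n := 0)).continuous).const_mul _) (by
    filter_upwards [ae_hasDerivAt_of_absolutelyContinuous hy.1.2, hy.2,
      unitMeasure_ae_of_forall fun t ht => hasDerivAt_D hy.1.1 ht] with t h1 h2 h3
    have := (h1.mul (hasDerivAt_cos_sub ρ x t)).add
      ((h3.mul (hasDerivAt_sinOver_sub ρ x t)).const_smul (-ρ ^ 2))
    refine this.congr_deriv ?_
    simp only [smul_eq_mul]
    linear_combination -Complex.cos (ρ * (x - t)) * h2)
  rw [intervalIntegral.integral_const_mul] at key
  simp only [sub_self, sinOver_zero, mul_zero, Complex.cos_zero, smul_eq_mul] at key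
  rw [duhamelDeriv]
  linear_combination key

end Representation

/-- The addition formula separates `x` from `t`: what remains is smooth functions of `x` times
integrals with variable upper limit, to which the product rule applies. -/
theorem duhamel_eq {q : ℝ → ℂ} (hq : IntervalIntegrable q volume 0 1) {a x : ℝ} (ρ : ℂ)
    (ha : a ∈ Icc (0 : ℝ) 1) (hx : x ∈ Icc (0 : ℝ) 1) :
    duhamel q a ρ x = sinOver ρ x * (∫ t in a..x, Complex.cos (ρ * t) * q t) -
      Complex.cos (ρ * x) * ∫ t in a..x, sinOver ρ t * q t := by
  have h1 := intervalIntegrable_mul_kernel hq ha hx (contDiff_cos_mul ρ (n := 0)).continuous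
  have h2 := intervalIntegrable_mul_kernel hq ha hx (contDiff_sinOver ρ (n := 0)).continuous
  rw [duhamel, ← intervalIntegral.integral_const_mul, ← intervalIntegral.integral_const_mul,
    ← intervalIntegral.integral_sub (h1.const_mul _) (h2.const_mul _)]
  congr 1 with t
  rw [sinOver_sub]; ring

theorem duhamelDeriv_eq {q : ℝ → ℂ} (hq : IntervalIntegrable q volume 0 1) {a x : ℝ} (ρ : ℂ)
    (ha : a ∈ Icc (0 : ℝ) 1) (hx : x ∈ Icc (0 : ℝ) 1) :
    duhamelDeriv q a ρ x = Complex.cos (ρ * x) * (∫ t in a..x, Complex.cos (ρ * t) * q t) +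
      ρ ^ 2 * sinOver ρ x * ∫ t in a..x, sinOver ρ t * q t := by
  have h1 := intervalIntegrable_mul_kernel hq ha hx (contDiff_cos_mul ρ (n := 0)).continuous
  have h2 := intervalIntegrable_mul_kernel hq ha hx (contDiff_sinOver ρ (n := 0)).continuous
  rw [duhamelDeriv, ← intervalIntegral.integral_const_mul, ← intervalIntegral.integral_const_mul,
    ← intervalIntegral.integral_add (h1.const_mul _) (h2.const_mul _)]
  congr 1 with t
  rw [cos_mul_sub]; ring

theorem ae_hasDerivAt_integral_mul {q f : ℝ → ℂ} (hq : IntervalIntegrable q volume 0 1)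
    (hf : Continuous f) {a : ℝ} (ha : a ∈ Icc (0 : ℝ) 1) :
    ∀ᵐ x ∂unitMeasure, HasDerivAt (fun x => ∫ t in a..x, f t * q t) (f x * q x) x := by
  have := (intervalIntegrable_mul_kernel hq (a := 0) (x := 1) (by simp) (by simp)
    hf).ae_hasDerivAt_integral
  rw [ae_restrict_iff' measurableSet_Ioo]
  have hu : uIcc (0 : ℝ) 1 = Icc 0 1 := uIcc_of_le zero_le_one
  filter_upwards [this] with x hx hm
  exact hx (hu ▸ Ioo_subset_Icc_self hm) a (hu ▸ ha)

theorem hasDerivAt_sinOver_ofReal (ρ : ℂ) (t : ℝ) :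
    HasDerivAt (fun t : ℝ => sinOver ρ t) (Complex.cos (ρ * t)) t :=
  (hasDerivAt_sinOver ρ t).comp_ofReal

theorem hasDerivAt_cos_mul_ofReal (ρ : ℂ) (t : ℝ) :
    HasDerivAt (fun t : ℝ => Complex.cos (ρ * t)) (-ρ ^ 2 * sinOver ρ t) t :=
  (hasDerivAt_cos_mul ρ t).comp_ofReal

/-! ### Existence of solutions with given Cauchy data -/

section Existence

variable {q : ℝ → ℂ} {a : ℝ} (hq : IntervalIntegrable q volume 0 1) (ha : a ∈ Icc (0 : ℝ) 1) (ρ : ℂ)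
include hq ha

theorem acOn_integral_mul {f : ℝ → ℂ} (hf : Continuous f) :
    AbsolutelyContinuousOnInterval (fun x => ∫ t in a..x, f t * q t) 0 1 :=
  absolutelyContinuousOnInterval_integral
    (intervalIntegrable_mul_kernel hq (by simp) (by simp) hf) (by rwa [uIcc_of_le zero_le_one])

theorem acOn_duhamel : AbsolutelyContinuousOnInterval (duhamel q a ρ) 0 1 := by
  have h1 := acOn_integral_mul hq ha (contDiff_cos_mul ρ (n := 0)).continuous
  have h2 := acOn_integral_mul hq ha (contDiff_sinOver ρ (n := 0)).continuous
  refine absolutelyContinuousOnInterval_congr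
    (((acOn_of_contDiff (contDiff_sinOver ρ)).smul h1).sub ((acOn_of_contDiff (contDiff_cos_mul ρ)).smul h2)) fun x hx => ?_
  rw [uIcc_of_le zero_le_one] at hx
  exact duhamel_eq hq ρ ha hx

theorem acOn_duhamelDeriv : AbsolutelyContinuousOnInterval (duhamelDeriv q a ρ) 0 1 := by
  have h1 := acOn_integral_mul hq ha (contDiff_cos_mul ρ (n := 0)).continuous
  have h2 := acOn_integral_mul hq ha (contDiff_sinOver ρ (n := 0)).continuous
  refine absolutelyContinuousOnInterval_congr
    (((acOn_of_contDiff (contDiff_cos_mul ρ)).smul h1).add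
      (((acOn_of_contDiff (contDiff_sinOver ρ)).smul h2).const_smul (ρ ^ 2))) fun x hx => ?_
  rw [uIcc_of_le zero_le_one] at hx
  rw [duhamelDeriv_eq hq ρ ha hx, mul_assoc (ρ ^ 2)]; rfl

theorem ae_hasDerivAt_duhamel :
    ∀ᵐ x ∂unitMeasure, HasDerivAt (duhamel q a ρ) (duhamelDeriv q a ρ x) x := by
  filter_upwards [ae_hasDerivAt_integral_mul hq (contDiff_cos_mul ρ (n := 0)).continuous ha,
    ae_hasDerivAt_integral_mul hq (contDiff_sinOver ρ (n := 0)).continuous ha,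
    ae_restrict_mem measurableSet_Ioo] with x h1 h2 hx
  have := ((hasDerivAt_sinOver_ofReal ρ x).mul h1).sub ((hasDerivAt_cos_mul_ofReal ρ x).mul h2)
  refine (this.congr_deriv ?_).congr_of_eventuallyEq ?_
  · rw [duhamelDeriv_eq hq ρ ha (Ioo_subset_Icc_self hx)]; ring
  · filter_upwards [Ioo_mem_nhds hx.1 hx.2] with z hz
    exact duhamel_eq hq ρ ha (Ioo_subset_Icc_self hz)

theorem ae_hasDerivAt_duhamelDeriv :
    ∀ᵐ x ∂unitMeasure, HasDerivAt (duhamelDeriv q a ρ) (q x - ρ ^ 2 * duhamel q a ρ x) x := by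
  filter_upwards [ae_hasDerivAt_integral_mul hq (contDiff_cos_mul ρ (n := 0)).continuous ha,
    ae_hasDerivAt_integral_mul hq (contDiff_sinOver ρ (n := 0)).continuous ha,
    ae_restrict_mem measurableSet_Ioo] with x h1 h2 hx
  have := ((hasDerivAt_cos_mul_ofReal ρ x).mul h1).add
    (((hasDerivAt_sinOver_ofReal ρ x).const_mul (ρ ^ 2)).mul h2)
  refine (this.congr_deriv ?_).congr_of_eventuallyEq ?_
  · rw [duhamel_eq hq ρ ha (Ioo_subset_Icc_self hx)]
    linear_combination (q x) * cos_sq_add_sinOver_sq ρ x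
  · filter_upwards [Ioo_mem_nhds hx.1 hx.2] with z hz
    exact duhamelDeriv_eq hq ρ ha (Ioo_subset_Icc_self hz)

theorem continuousOn_duhamelDeriv : ContinuousOn (duhamelDeriv q a ρ) (Icc 0 1) := by
  have := (acOn_duhamelDeriv hq ha ρ).continuousOn
  rwa [uIcc_of_le zero_le_one] at this

/-- Upgrades the almost everywhere derivative to a derivative at every point of `[0,1]`: the
candidate derivative is continuous and the Duhamel term is its primitive. -/
theorem hasDerivWithinAt_duhamel {x : ℝ} (hx : x ∈ Icc (0 : ℝ) 1) :
    HasDerivWithinAt (duhamel q a ρ) (duhamelDeriv q a ρ x) (Icc 0 1) x := by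
  have hc := continuousOn_duhamelDeriv hq ha ρ
  have hi : IntervalIntegrable (duhamelDeriv q a ρ) volume 0 1 :=
    (hc.mono (by rw [uIcc_of_le zero_le_one])).intervalIntegrable
  have hrep : ∀ z ∈ Icc (0 : ℝ) 1,
      duhamel q a ρ z = duhamel q a ρ a + ∫ t in a..z, duhamelDeriv q a ρ t := fun z hz =>
    eq_add_integral_of_absolutelyContinuous ha hz (acOn_duhamel hq ha ρ) hi
      (ae_hasDerivAt_duhamel hq ha ρ)
  -- Supplies the `FTCFilter` instance for neighbourhoods within `Icc`, which covers the one-sided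
  -- derivatives at `0` and `1`.
  have : Fact (x ∈ Icc (0 : ℝ) 1) := ⟨hx⟩
  have := intervalIntegral.integral_hasDerivWithinAt_right (a := a) (b := x)
    (s := Icc (0 : ℝ) 1) (t := Icc (0 : ℝ) 1)
    (hi.mono_set (by rw [uIcc_of_le zero_le_one]; exact uIcc_subset_Icc ha hx))
    (hc.stronglyMeasurableAtFilter_nhdsWithin measurableSet_Icc x) (hc x hx)
  exact (this.const_add _).congr hrep (hrep x hx)

end Existence

/-- The solution of `-y'' + q y(a) = ρ² y` with `y(a) = u`, `y'(a) = v`. -/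
def cauchySol (q : ℝ → ℂ) (a : ℝ) (ρ u v : ℂ) (x : ℝ) : ℂ :=
  u * Complex.cos (ρ * (x - a)) + v * sinOver ρ (x - a) + u * duhamel q a ρ x

/-- The derivative of `cauchySol`. -/
def cauchySolDeriv (q : ℝ → ℂ) (a : ℝ) (ρ u v : ℂ) (x : ℝ) : ℂ :=
  -ρ ^ 2 * u * sinOver ρ (x - a) + v * Complex.cos (ρ * (x - a)) + u * duhamelDeriv q a ρ x

theorem hasDerivAt_sinOver_sub_const (ρ : ℂ) (a t : ℝ) :
    HasDerivAt (fun t : ℝ => sinOver ρ (t - a)) (Complex.cos (ρ * (t - a))) t := by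
  have h := (hasDerivAt_sinOver ρ (t - a)).comp_of_eq (t : ℂ) ((hasDerivAt_id (t : ℂ)).sub_const (a : ℂ)) rfl
  simpa using h.comp_ofReal

theorem hasDerivAt_cos_sub_const (ρ : ℂ) (a t : ℝ) :
    HasDerivAt (fun t : ℝ => Complex.cos (ρ * (t - a))) (-ρ ^ 2 * sinOver ρ (t - a)) t := by
  have h := (hasDerivAt_cos_mul ρ (t - a)).comp_of_eq (t : ℂ) ((hasDerivAt_id (t : ℂ)).sub_const (a : ℂ)) rfl
  simpa using h.comp_ofReal

theorem contDiff_sinOver_sub_const (ρ : ℂ) (x : ℝ) {n : WithTop ℕ∞} :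
    ContDiff ℝ n (fun t : ℝ => sinOver ρ (t - x)) := by
  have := (contDiff_sinOver ρ (n := n)).comp (contDiff_id.sub contDiff_const : ContDiff ℝ n fun t : ℝ => t - x)
  simpa [Function.comp_def] using this

theorem contDiff_cos_sub_const (ρ : ℂ) (x : ℝ) {n : WithTop ℕ∞} :
    ContDiff ℝ n (fun t : ℝ => Complex.cos (ρ * (t - x))) := by
  have := (contDiff_cos_mul ρ (n := n)).comp (contDiff_id.sub contDiff_const : ContDiff ℝ n fun t : ℝ => t - x)
  simpa [Function.comp_def] using this

@[simp] theorem duhamel_self (q : ℝ → ℂ) (a : ℝ) (ρ : ℂ) : duhamel q a ρ a = 0 := by simp [duhamel]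
@[simp] theorem duhamelDeriv_self (q : ℝ → ℂ) (a : ℝ) (ρ : ℂ) : duhamelDeriv q a ρ a = 0 := by
  simp [duhamelDeriv]

@[simp] theorem cauchySol_self (q : ℝ → ℂ) (a : ℝ) (ρ u v : ℂ) : cauchySol q a ρ u v a = u := by
  simp [cauchySol]

@[simp] theorem cauchySolDeriv_self (q : ℝ → ℂ) (a : ℝ) (ρ u v : ℂ) :
    cauchySolDeriv q a ρ u v a = v := by
  simp [cauchySolDeriv]

section

variable (q : L2) {a : ℝ} (ha : a ∈ Icc (0 : ℝ) 1) (ρ u v : ℂ)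
include ha

theorem hasDerivWithinAt_cauchySol {x : ℝ} (hx : x ∈ Icc (0 : ℝ) 1) :
    HasDerivWithinAt (cauchySol q a ρ u v) (cauchySolDeriv q a ρ u v x) (Icc 0 1) x := by
  have := (((hasDerivAt_cos_sub_const ρ a x).hasDerivWithinAt (s := Icc 0 1)).const_mul u).add
    (((hasDerivAt_sinOver_sub_const ρ a x).hasDerivWithinAt (s := Icc 0 1)).const_mul v) |>.add
    ((hasDerivWithinAt_duhamel (intervalIntegrable_L2 q) ha ρ hx).const_mul u)
  refine this.congr_deriv ?_
  rw [cauchySolDeriv]; ring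

theorem D_cauchySol {x : ℝ} (hx : x ∈ Icc (0 : ℝ) 1) :
    D (cauchySol q a ρ u v) x = cauchySolDeriv q a ρ u v x :=
  (hasDerivWithinAt_cauchySol q ha ρ u v hx).derivWithin (uniqueDiffOn_Icc zero_lt_one x hx)

theorem isSolution_cauchySol : IsSolution q a (ρ ^ 2) (cauchySol q a ρ u v) := by
  have hq := intervalIntegrable_L2 q
  have heq : ∀ᵐ x ∂unitMeasure, D (D (cauchySol q a ρ u v)) x =
      u * q x - ρ ^ 2 * cauchySol q a ρ u v x := by
    filter_upwards [ae_hasDerivAt_duhamelDeriv hq ha ρ, ae_restrict_mem measurableSet_Ioo]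
      with x h1 hx
    have hx' := Ioo_subset_Icc_self hx
    have := ((((hasDerivAt_sinOver_sub_const ρ a x).const_mul (-ρ ^ 2 * u)).add
      ((hasDerivAt_cos_sub_const ρ a x).const_mul v)).add (h1.const_mul u))
    have h2 := this.hasDerivWithinAt (s := Icc 0 1)
    have h3 : HasDerivWithinAt (D (cauchySol q a ρ u v)) _ (Icc 0 1) x :=
      h2.congr (fun z hz => D_cauchySol q ha ρ u v hz) (D_cauchySol q ha ρ u v hx')
    rw [D, h3.derivWithin (uniqueDiffOn_Icc zero_lt_one x hx'), cauchySol]; ring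
  have hd : DifferentiableOn ℝ (cauchySol q a ρ u v) (Icc 0 1) := fun x hx =>
    (hasDerivWithinAt_cauchySol q ha ρ u v hx).differentiableWithinAt
  refine ⟨⟨hd, ?_, ?_⟩, ?_⟩
  · refine absolutelyContinuousOnInterval_congr ((((acOn_of_contDiff (contDiff_sinOver_sub_const ρ a)).const_smul
      (-ρ ^ 2 * u)).add ((acOn_of_contDiff (contDiff_cos_sub_const ρ a)).const_smul v)).add
      ((acOn_duhamelDeriv hq ha ρ).const_smul u)) fun x hx => ?_
    rw [uIcc_of_le zero_le_one] at hx
    rw [D_cauchySol q ha ρ u v hx]; rfl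
  · refine MemLp.ae_eq (f := fun x => u * q x - ρ ^ 2 * cauchySol q a ρ u v x) ?_
      (((Lp.memLp q).const_mul u).sub
      ((memLp_of_continuousOn hd.continuousOn).const_mul (ρ ^ 2)))
    filter_upwards [heq] with x hx using hx.symm
  · filter_upwards [heq] with x hx
    rw [hx, cauchySol_self]; ring

end

/-! ### Characteristic determinant and eigenvalues -/

/-- The characteristic determinant, as a function of the square root of the spectral parameter. -/
def charDet (q : ℝ → ℂ) (a : ℝ) (γ ρ : ℂ) : ℂ :=
  (cauchySol q a ρ 1 0 0 - γ * cauchySol q a ρ 1 0 1) *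
    (cauchySolDeriv q a ρ 0 1 0 - γ * cauchySolDeriv q a ρ 0 1 1) -
  (cauchySol q a ρ 0 1 0 - γ * cauchySol q a ρ 0 1 1) *
    (cauchySolDeriv q a ρ 1 0 0 - γ * cauchySolDeriv q a ρ 1 0 1)

section

variable {q : L2} {a : ℝ} {ρ γ : ℂ} {y : ℝ → ℂ}

theorem IsSolution.eq_cauchySol (hy : IsSolution q a (ρ ^ 2) y) (ha : a ∈ Icc (0 : ℝ) 1) {x : ℝ}
    (hx : x ∈ Icc (0 : ℝ) 1) : y x = cauchySol q a ρ (y a) (D y a) x :=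
  hy.apply_eq ha hx

theorem IsSolution.D_eq_cauchySolDeriv (hy : IsSolution q a (ρ ^ 2) y) (ha : a ∈ Icc (0 : ℝ) 1)
    {x : ℝ} (hx : x ∈ Icc (0 : ℝ) 1) : D y x = cauchySolDeriv q a ρ (y a) (D y a) x :=
  hy.deriv_eq ha hx

/-- The solutions `C` and `S` are forced on `[0,1]` by their Cauchy data, so the characteristic
function does not depend on the choice made in its definition. -/
theorem IsCharFunction.apply_sq {Δ : ℂ → ℂ} (h : IsCharFunction q a γ Δ) (ha : a ∈ Icc (0 : ℝ) 1)
    (ρ : ℂ) : Δ (ρ ^ 2) = charDet q a γ ρ := by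
  obtain ⟨C, S, hC, hS, h1, h2, h3, h4, h5⟩ := h (ρ ^ 2)
  have z : (0 : ℝ) ∈ Icc (0 : ℝ) 1 := by simp
  have o : (1 : ℝ) ∈ Icc (0 : ℝ) 1 := by simp
  rw [h5, Matrix.det_fin_two_of, hC.eq_cauchySol ha z, hC.eq_cauchySol ha o,
    hS.eq_cauchySol ha z, hS.eq_cauchySol ha o, hC.D_eq_cauchySolDeriv ha z,
    hC.D_eq_cauchySolDeriv ha o, hS.D_eq_cauchySolDeriv ha z, hS.D_eq_cauchySolDeriv ha o,
    h1, h2, h3, h4, charDet]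

theorem isCharFunction_of_apply_sq {Δ : ℂ → ℂ} (ha : a ∈ Icc (0 : ℝ) 1)
    (h : ∀ ρ, Δ (ρ ^ 2) = charDet q a γ ρ) : IsCharFunction q a γ Δ := by
  intro μ
  obtain ⟨ρ, rfl⟩ : ∃ ρ : ℂ, μ = ρ ^ 2 := by
    obtain ⟨ρ, hρ⟩ := IsAlgClosed.exists_pow_nat_eq μ zero_lt_two
    exact ⟨ρ, hρ.symm⟩
  refine ⟨cauchySol q a ρ 1 0, cauchySol q a ρ 0 1, isSolution_cauchySol q ha ρ 1 0,
    isSolution_cauchySol q ha ρ 0 1, by simp, ?_, by simp, ?_, ?_⟩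
  · simp [D_cauchySol q ha ρ _ _ ha]
  · simp [D_cauchySol q ha ρ _ _ ha]
  · have z : (0 : ℝ) ∈ Icc (0 : ℝ) 1 := by simp
    have o : (1 : ℝ) ∈ Icc (0 : ℝ) 1 := by simp
    rw [h, Matrix.det_fin_two_of, D_cauchySol q ha ρ _ _ z, D_cauchySol q ha ρ _ _ o,
      D_cauchySol q ha ρ _ _ z, D_cauchySol q ha ρ _ _ o, charDet]

theorem cauchySol_eq_add (q : ℝ → ℂ) (a : ℝ) (ρ u v : ℂ) (x : ℝ) :
    cauchySol q a ρ u v x = u * cauchySol q a ρ 1 0 x + v * cauchySol q a ρ 0 1 x := by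
  simp only [cauchySol]; ring

theorem cauchySolDeriv_eq_add (q : ℝ → ℂ) (a : ℝ) (ρ u v : ℂ) (x : ℝ) :
    cauchySolDeriv q a ρ u v x =
      u * cauchySolDeriv q a ρ 1 0 x + v * cauchySolDeriv q a ρ 0 1 x := by
  simp only [cauchySolDeriv]; ring

/-- A solution is a linear combination of `C` and `S` with coefficients `y(a)`, `y'(a)`, so the
boundary conditions are a linear 2 × 2 system for these two numbers. -/
theorem isEigenvalue_sq_iff (ha : a ∈ Icc (0 : ℝ) 1) :
    IsEigenvalue q a γ (ρ ^ 2) ↔ charDet q a γ ρ = 0 := by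
  have z : (0 : ℝ) ∈ Icc (0 : ℝ) 1 := by simp
  have o : (1 : ℝ) ∈ Icc (0 : ℝ) 1 := by simp
  set M : Matrix (Fin 2) (Fin 2) ℂ :=
    !![cauchySol q a ρ 1 0 0 - γ * cauchySol q a ρ 1 0 1,
       cauchySol q a ρ 0 1 0 - γ * cauchySol q a ρ 0 1 1;
       cauchySolDeriv q a ρ 1 0 0 - γ * cauchySolDeriv q a ρ 1 0 1,
       cauchySolDeriv q a ρ 0 1 0 - γ * cauchySolDeriv q a ρ 0 1 1] with hM
  have hdet : M.det = charDet q a γ ρ := by rw [hM, Matrix.det_fin_two_of, charDet]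
  rw [← hdet, ← Matrix.exists_mulVec_eq_zero_iff]
  constructor
  · rintro ⟨y, hy, h0, h1, x, hx, hne⟩
    refine ⟨![y a, D y a], fun h => ?_, ?_⟩
    · have e1 : y a = 0 := by simpa using congrFun h 0
      have e2 : D y a = 0 := by simpa using congrFun h 1
      apply hne
      rw [hy.eq_cauchySol ha hx, e1, e2]; simp [cauchySol]
    · rw [hy.eq_cauchySol ha z, hy.eq_cauchySol ha o, cauchySol_eq_add,
        cauchySol_eq_add _ _ _ _ _ 1] at h0
      rw [hy.D_eq_cauchySolDeriv ha z, hy.D_eq_cauchySolDeriv ha o, cauchySolDeriv_eq_add,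
        cauchySolDeriv_eq_add _ _ _ _ _ 1] at h1
      ext i
      fin_cases i
      · simp [hM, Matrix.mulVec, dotProduct, Fin.sum_univ_two]
        linear_combination h0
      · simp [hM, Matrix.mulVec, dotProduct, Fin.sum_univ_two]
        linear_combination h1
  · rintro ⟨w, hw, hMw⟩
    have h0 := congrFun hMw 0
    have h1 := congrFun hMw 1
    simp [hM, Matrix.mulVec, dotProduct, Fin.sum_univ_two] at h0 h1
    refine ⟨cauchySol q a ρ (w 0) (w 1), isSolution_cauchySol q ha ρ _ _, ?_, ?_, ?_⟩
    · rw [cauchySol_eq_add, cauchySol_eq_add _ _ _ _ _ 1]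
      linear_combination h0
    · rw [D_cauchySol q ha ρ _ _ z, D_cauchySol q ha ρ _ _ o, cauchySolDeriv_eq_add,
        cauchySolDeriv_eq_add _ _ _ _ _ 1]
      linear_combination h1
    · by_contra! hcon
      apply hw
      have e1 : w 0 = 0 := by simpa using hcon a ha
      -- The second Cauchy datum is the derivative at `a` of a function vanishing on all of `[0,1]`.
      have e2 : w 1 = 0 := by
        have h3 := D_cauchySol q ha ρ (w 0) (w 1) ha
        rw [cauchySolDeriv_self] at h3
        rw [← h3, D, derivWithin_congr (f := fun _ => (0 : ℂ)) hcon (hcon a ha)]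
        simp
      ext i; fin_cases i <;> simp [e1, e2]

end

/-! ### Unfolding the potential around `a` -/

/-- The potential `q` unfolded around the frozen argument: `q (a - u)` on `(0,a)`, continued by the
quasi-periodicity factor `γ`. -/
def unfoldAt (a : ℝ) (γ : ℂ) (q : ℝ → ℂ) (u : ℝ) : ℂ :=
  if u < a then q (a - u) else γ * q (1 + a - u)

/-- The reflections `t ↦ a - t` and `t ↦ 1 + a - t` preserve Lebesgue measure and map `(0,a)` and
`(a,1)` onto themselves, so properties valid almost everywhere can be pulled back. -/
theorem ae_comp_unfoldAt {a : ℝ} (ha : a ∈ Icc (0 : ℝ) 1) {p : ℝ → Prop}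
    (h : ∀ᵐ u ∂unitMeasure, p u) :
    ∀ᵐ t ∂unitMeasure, (t < a → p (a - t)) ∧ (a < t → p (1 + a - t)) ∧ t ≠ a := by
  rw [ae_restrict_iff' measurableSet_Ioo] at h ⊢
  have h1 := (Measure.measurePreserving_sub_left volume a).quasiMeasurePreserving.ae h
  have h2 := (Measure.measurePreserving_sub_left volume (1 + a)).quasiMeasurePreserving.ae h
  have h3 : ∀ᵐ t : ℝ, t ≠ a := by simp [ae_iff, measure_singleton]
  filter_upwards [h1, h2, h3] with t h1 h2 h3 ht
  refine ⟨fun hta => h1 ⟨by linarith, by linarith [ht.1, ha.2]⟩,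
    fun hta => h2 ⟨by linarith [ha.1, ht.2], by linarith⟩, h3⟩

theorem ae_comp_one_sub {p : ℝ → Prop} (h : ∀ᵐ u ∂unitMeasure, p u) :
    ∀ᵐ t ∂unitMeasure, p (1 - t) := by
  filter_upwards [ae_comp_unfoldAt (a := 1) (by simp) h, ae_restrict_mem measurableSet_Ioo]
    with t ht hm using ht.1 hm.2

theorem memLp_ite {a : ℝ} (ha : a ∈ Icc (0 : ℝ) 1) {f g : ℝ → ℂ} (hf : MemLp f 2 unitMeasure)
    (hg : MemLp g 2 unitMeasure) :
    MemLp (fun u => if u < a then f (a - u) else g (1 + a - u)) 2 unitMeasure := by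
  rw [← memLp_indicator_iff_restrict measurableSet_Ioo] at hf hg
  have h1 := hf.comp_measurePreserving (Measure.measurePreserving_sub_left volume a)
  have h2 := hg.comp_measurePreserving (Measure.measurePreserving_sub_left volume (1 + a))
  refine MemLp.ae_eq ?_ ((h1.add h2).restrict (Ioo 0 1))
  filter_upwards [ae_restrict_mem measurableSet_Ioo,
    ae_restrict_of_ae (by simp [ae_iff, measure_singleton] : ∀ᵐ t : ℝ, t ≠ a)] with t ht hne
  simp only [Pi.add_apply, Function.comp_apply]
  rcases lt_or_gt_of_ne hne with h | h
  · rw [indicator_of_mem (show a - t ∈ Ioo (0 : ℝ) 1 from ⟨by linarith, by linarith [ht.1, ha.2]⟩),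
      indicator_of_notMem (fun hm => by linarith [hm.2, ht.1]), if_pos h, add_zero]
  · rw [indicator_of_notMem (fun hm => by linarith [hm.1, ht.1]),
      indicator_of_mem (show 1 + a - t ∈ Ioo (0 : ℝ) 1 from
        ⟨by linarith [ha.1, ht.2], by linarith⟩), if_neg h.not_gt, zero_add]

theorem memLp_comp_one_sub {f : ℝ → ℂ} (hf : MemLp f 2 unitMeasure) :
    MemLp (fun u => f (1 - u)) 2 unitMeasure := by
  refine MemLp.ae_eq (unitMeasure_ae_of_forall fun u hu => ?_) (memLp_ite (a := 1) (by simp) hf hf)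
  simp [hu.2]

theorem memLp_unfoldAt {a : ℝ} (ha : a ∈ Icc (0 : ℝ) 1) (γ : ℂ) {q : ℝ → ℂ}
    (hq : MemLp q 2 unitMeasure) : MemLp (unfoldAt a γ q) 2 unitMeasure :=
  memLp_ite ha hq (hq.const_mul γ)

/-- Unfolding is undone by the same two reflections, with `γ⁻¹` in place of `γ`. -/
theorem exists_unfoldAt_eq {a : ℝ} (ha : a ∈ Icc (0 : ℝ) 1) {γ : ℂ} (hγ : γ ≠ 0) {X : ℝ → ℂ}
    (hX : MemLp X 2 unitMeasure) : ∃ q : L2, unfoldAt a γ q =ᵐ[unitMeasure] X := by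
  have hm := memLp_ite ha hX (hX.const_mul γ⁻¹)
  refine ⟨hm.toLp _, ?_⟩
  filter_upwards [ae_comp_unfoldAt ha hm.coeFn_toLp, ae_restrict_mem measurableSet_Ioo] with u hu hmem
  rw [unfoldAt]
  rcases lt_or_gt_of_ne hu.2.2 with h | h
  · rw [if_pos h, hu.1 h, if_pos (by linarith [hmem.1]), sub_sub_cancel]
  · rw [if_neg h.not_gt, hu.2.1 h, if_neg (by linarith [hmem.2]), sub_sub_cancel,
      mul_inv_cancel_left₀ hγ]

theorem eq_of_unfoldAt_eq {a : ℝ} (ha : a ∈ Icc (0 : ℝ) 1) {γ : ℂ} (hγ : γ ≠ 0) {q₁ q₂ : L2}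
    (h : unfoldAt a γ q₁ =ᵐ[unitMeasure] unfoldAt a γ q₂) : q₁ = q₂ := by
  apply Lp.ext
  filter_upwards [ae_comp_unfoldAt ha h, ae_restrict_mem measurableSet_Ioo] with t ht hmem
  rcases lt_or_gt_of_ne ht.2.2 with h | h
  · have := ht.1 h
    simpa [unfoldAt, hmem.1] using this
  · have := ht.2.1 h
    simpa [unfoldAt, show ¬ 1 + a - t < a by linarith [hmem.2], hγ] using this

theorem integral_unfoldAt_mul {a : ℝ} (ha : a ∈ Icc (0 : ℝ) 1) (γ : ℂ) {q : ℝ → ℂ}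
    (hq : MemLp q 2 unitMeasure) {g : ℝ → ℂ} (hg : Continuous g) :
    ∫ u in (0 : ℝ)..1, unfoldAt a γ q u * g u =
      (∫ t in (0 : ℝ)..a, g (a - t) * q t) + γ * ∫ t in a..1, g (1 + a - t) * q t := by
  have hi : ∀ x ∈ Icc (0 : ℝ) 1, ∀ y ∈ Icc (0 : ℝ) 1,
      IntervalIntegrable (fun u => unfoldAt a γ q u * g u) volume x y := fun x hx y hy => by
    have := intervalIntegrable_mul_kernel
      (intervalIntegrable_of_memLp_two (memLp_unfoldAt ha γ hq)) hx hy hg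
    simpa only [mul_comm] using this
  rw [← intervalIntegral.integral_add_adjacent_intervals (hi 0 (by simp) a ha) (hi a ha 1 (by simp))]
  congr 1
  · have := intervalIntegral.integral_comp_sub_left (a := 0) (b := a) (fun t => q t * g (a - t)) a
    simp only [sub_sub_cancel, sub_zero, sub_self] at this
    simp only [mul_comm (g _)]
    rw [← this]
    refine intervalIntegral.integral_congr_ae ?_
    filter_upwards [(by simp [ae_iff, measure_singleton] : ∀ᵐ t : ℝ, t ≠ a)] with u hne hu
    rw [uIoc_of_le ha.1] at hu
    rw [unfoldAt, if_pos (lt_of_le_of_ne hu.2 hne)]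
  · have := intervalIntegral.integral_comp_sub_left (a := a) (b := 1)
      (fun t => q t * g (1 + a - t)) (1 + a)
    simp only [sub_sub_cancel, add_sub_cancel_right, add_sub_cancel_left] at this
    simp only [mul_comm (g _)]
    rw [← this, ← intervalIntegral.integral_const_mul]
    refine intervalIntegral.integral_congr fun u hu => ?_
    rw [uIcc_of_le ha.2] at hu
    simp only [unfoldAt, if_neg hu.1.not_gt, mul_assoc]

/-- The solution `S` vanishes at `a` and does not see `q`, so `q` enters only one column of the
determinant and no quadratic terms appear. Addition formulas reduce both sides to the four moments
of `q` against `cos(ρ(t - a))` and `sin(ρ(t - a))/ρ` on the two sides of `a`. -/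
theorem charDet_eq {a : ℝ} (ha : a ∈ Icc (0 : ℝ) 1) (γ ρ : ℂ) {q : ℝ → ℂ}
    (hq : MemLp q 2 unitMeasure) :
    charDet q a γ ρ = 1 + γ ^ 2 - 2 * γ * Complex.cos ρ -
      ∫ u in (0 : ℝ)..1, unfoldAt a γ q u * (sinOver ρ u + γ * sinOver ρ (1 - u)) := by
  have hqi := intervalIntegrable_of_memLp_two hq
  have z : (0 : ℝ) ∈ Icc (0 : ℝ) 1 := by simp
  have o : (1 : ℝ) ∈ Icc (0 : ℝ) 1 := by simp
  set E₁ := ∫ t in (0 : ℝ)..a, Complex.cos (ρ * (t - a)) * q t with hE₁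
  set F₁ := ∫ t in (0 : ℝ)..a, sinOver ρ (t - a) * q t with hF₁
  set E₂ := ∫ t in a..1, Complex.cos (ρ * (t - a)) * q t with hE₂
  set F₂ := ∫ t in a..1, sinOver ρ (t - a) * q t with hF₂
  have hc := (contDiff_cos_sub_const ρ a (n := 0)).continuous
  have hs := (contDiff_sinOver_sub_const ρ a (n := 0)).continuous
  have iE₁ := intervalIntegrable_mul_kernel hqi z ha hc
  have iF₁ := intervalIntegrable_mul_kernel hqi z ha hs
  have iE₂ := intervalIntegrable_mul_kernel hqi ha o hc
  have iF₂ := intervalIntegrable_mul_kernel hqi ha o hs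
  have lin₁ : ∀ A B : ℂ, (∫ t in (0 : ℝ)..a,
      (A * Complex.cos (ρ * (t - a)) + B * sinOver ρ (t - a)) * q t) = A * E₁ + B * F₁ := by
    intro A B
    rw [hE₁, hF₁, ← intervalIntegral.integral_const_mul, ← intervalIntegral.integral_const_mul,
      ← intervalIntegral.integral_add (iE₁.const_mul _) (iF₁.const_mul _)]
    congr 1 with t; ring
  have lin₂ : ∀ A B : ℂ, (∫ t in a..1,
      (A * Complex.cos (ρ * (t - a)) + B * sinOver ρ (t - a)) * q t) = A * E₂ + B * F₂ := by
    intro A B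
    rw [hE₂, hF₂, ← intervalIntegral.integral_const_mul, ← intervalIntegral.integral_const_mul,
      ← intervalIntegral.integral_add (iE₂.const_mul _) (iF₂.const_mul _)]
    congr 1 with t; ring
  set ca := Complex.cos (ρ * a) with hca
  set sa := sinOver ρ a with hsa
  set b : ℂ := 1 - a with hb
  set cb := Complex.cos (ρ * b) with hcb
  set sb := sinOver ρ b with hsb
  have hab : (1 : ℂ) = a + b := by rw [hb]; ring
  have c1 : Complex.cos (ρ * 1) = ca * cb - ρ ^ 2 * sa * sb := by rw [hab, cos_mul_add]
  have s1 : sinOver ρ 1 = sa * cb + ca * sb := by rw [hab, sinOver_add]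
  have p0 : duhamel q a ρ 0 = sa * E₁ + ca * F₁ := by
    rw [duhamel, intervalIntegral.integral_symm, ← intervalIntegral.integral_neg, ← lin₁]
    congr 1 with t
    rw [show ((0 : ℝ) : ℂ) - t = -((t - a) + a) by push_cast; ring, sinOver_neg, sinOver_add]; ring
  have p0' : duhamelDeriv q a ρ 0 = -ca * E₁ + ρ ^ 2 * sa * F₁ := by
    rw [duhamelDeriv, intervalIntegral.integral_symm, ← intervalIntegral.integral_neg, ← lin₁]
    congr 1 with t
    rw [show ((0 : ℝ) : ℂ) - t = -((t - a) + a) by push_cast; ring, mul_neg, Complex.cos_neg,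
      cos_mul_add]; ring
  have p1 : duhamel q a ρ 1 = sb * E₂ + (-cb) * F₂ := by
    rw [duhamel, ← lin₂]
    congr 1 with t
    rw [show ((1 : ℝ) : ℂ) - t = b - (t - a) by rw [hb]; push_cast; ring, sinOver_sub]; ring
  have p1' : duhamelDeriv q a ρ 1 = cb * E₂ + ρ ^ 2 * sb * F₂ := by
    rw [duhamelDeriv, ← lin₂]
    congr 1 with t
    rw [show ((1 : ℝ) : ℂ) - t = b - (t - a) by rw [hb]; push_cast; ring, cos_mul_sub]
  have hint : (∫ u in (0 : ℝ)..1, unfoldAt a γ q u * (sinOver ρ u + γ * sinOver ρ (1 - u))) =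
      (γ * sinOver ρ 1 * E₁ + (-1 + γ * Complex.cos (ρ * 1)) * F₁) +
      γ * (sinOver ρ 1 * E₂ + (-Complex.cos (ρ * 1) + γ) * F₂) := by
    have hcont : Continuous fun u : ℝ => sinOver ρ u + γ * sinOver ρ (1 - u) := by fun_prop
    have := integral_unfoldAt_mul ha γ hq hcont
    rw [this, ← lin₁, ← lin₂]
    congr 1
    · congr 1 with t
      rw [show ((a - t : ℝ) : ℂ) = -(t - a) by push_cast; ring, sinOver_neg,
        show (1 : ℂ) - -(t - a) = 1 + (t - a) by ring, sinOver_add]; ring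
    · congr 2 with t
      rw [show ((1 + a - t : ℝ) : ℂ) = 1 - (t - a) by push_cast; ring, sinOver_sub,
        sub_sub_cancel]; ring
  rw [mul_one] at c1
  rw [hint, s1, mul_one, c1, charDet]
  simp only [cauchySol, cauchySolDeriv, p0, p0', p1, p1']
  rw [show ((0 : ℝ) : ℂ) - a = -a by simp, show ((1 : ℝ) : ℂ) - a = b by simp [hb], sinOver_neg,
    mul_neg, Complex.cos_neg, ← hca, ← hsa, ← hcb, ← hsb]
  -- The two sides agree up to the Pythagorean identity at the lengths `a` and `b = 1 - a`.
  linear_combination (1 + F₁) * cos_sq_add_sinOver_sq ρ a +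
    γ ^ 2 * (1 - F₂) * cos_sq_add_sinOver_sq ρ b

theorem unfoldAt_ae_congr {a : ℝ} {γ : ℂ} {q : ℝ → ℂ} {X : ℝ → ℂ} {g : ℝ → ℂ}
    (h : unfoldAt a γ q =ᵐ[unitMeasure] X) :
    ∫ u in (0 : ℝ)..1, unfoldAt a γ q u * g u = ∫ u in (0 : ℝ)..1, X u * g u := by
  rw [intervalIntegral.integral_of_le zero_le_one, intervalIntegral.integral_of_le zero_le_one,
    ← restrict_Ioo_eq_restrict_Ioc]
  refine integral_congr_ae ?_
  filter_upwards [h] with u hu; rw [hu]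

/-- Folding the kernel `sinOver ρ u + γ sinOver ρ (1 - u)` onto the other factor. -/
theorem integral_fold {X : ℝ → ℂ} (hX : MemLp X 2 unitMeasure) (γ ρ : ℂ) :
    ∫ u in (0 : ℝ)..1, X u * (sinOver ρ u + γ * sinOver ρ (1 - u)) =
      ∫ u in (0 : ℝ)..1, (X u + γ * X (1 - u)) * sinOver ρ u := by
  have z : (0 : ℝ) ∈ Icc (0 : ℝ) 1 := by simp
  have o : (1 : ℝ) ∈ Icc (0 : ℝ) 1 := by simp
  have h1 := intervalIntegrable_mul_kernel (intervalIntegrable_of_memLp_two hX) z o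
    (contDiff_sinOver ρ (n := 0)).continuous
  have h2 := intervalIntegrable_mul_kernel (intervalIntegrable_of_memLp_two hX) z o
    (f := fun u : ℝ => sinOver ρ (1 - u)) (by fun_prop)
  have h3 := intervalIntegrable_mul_kernel
    (intervalIntegrable_of_memLp_two (memLp_comp_one_sub hX)) z o
    (contDiff_sinOver ρ (n := 0)).continuous
  have e := intervalIntegral.integral_comp_sub_left (a := 0) (b := 1)
    (fun u => sinOver ρ (1 - u) * X u) 1
  simp only [Complex.ofReal_sub, Complex.ofReal_one, sub_sub_cancel, sub_self, sub_zero] at e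
  calc _ = ∫ u in (0 : ℝ)..1, (sinOver ρ u * X u + γ * (sinOver ρ (1 - u) * X u)) := by
        congr 1 with u; ring
    _ = ∫ u in (0 : ℝ)..1, (sinOver ρ u * X u + γ * (sinOver ρ u * X (1 - u))) := by
        rw [intervalIntegral.integral_add h1 (h2.const_mul γ),
          intervalIntegral.integral_add h1 (h3.const_mul γ), intervalIntegral.integral_const_mul,
          intervalIntegral.integral_const_mul, e]
    _ = _ := by congr 1 with u; ring

/-! ### Growth and analyticity of the sine transform -/

theorem norm_exp_mul_I_le (z : ℂ) : ‖Complex.exp (z * Complex.I)‖ ≤ Real.exp |z.im| := by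
  rw [Complex.norm_exp]; simp [neg_le_abs]

theorem norm_exp_neg_mul_I_le (z : ℂ) : ‖Complex.exp (-z * Complex.I)‖ ≤ Real.exp |z.im| := by
  rw [Complex.norm_exp]; simp [le_abs_self]

theorem norm_cos_le (z : ℂ) : ‖Complex.cos z‖ ≤ Real.exp |z.im| := by
  rw [Complex.cos, norm_div, Complex.norm_ofNat, div_le_iff₀ two_pos]
  refine (norm_add_le _ _).trans ?_
  linarith [norm_exp_mul_I_le z, norm_exp_neg_mul_I_le z]

theorem norm_sin_le (z : ℂ) : ‖Complex.sin z‖ ≤ Real.exp |z.im| := by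
  rw [Complex.sin, norm_div, Complex.norm_ofNat, div_le_iff₀ two_pos, norm_mul, Complex.norm_I,
    mul_one]
  refine (norm_sub_le _ _).trans ?_
  linarith [norm_exp_mul_I_le z, norm_exp_neg_mul_I_le z]

theorem abs_im_mul_le {ρ : ℂ} {u : ℝ} (hu : u ∈ Icc (0 : ℝ) 1) : |(ρ * u).im| ≤ |ρ.im| := by
  rw [Complex.im_mul_ofReal, abs_mul, abs_of_nonneg hu.1]
  exact mul_le_of_le_one_right (abs_nonneg _) hu.2

/-- The sine transform of a function on `(0,1)`. -/
def sinTransform (W : ℝ → ℂ) (ρ : ℂ) : ℂ := ∫ u in (0 : ℝ)..1, W u * sinOver ρ u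

theorem mul_sinTransform (W : ℝ → ℂ) (ρ : ℂ) :
    ρ * sinTransform W ρ = ∫ u in (0 : ℝ)..1, W u * Complex.sin (ρ * u) := by
  rw [sinTransform, ← intervalIntegral.integral_const_mul]
  congr 1 with u
  rw [← mul_sinOver]; ring

theorem norm_mul_sinTransform_le {W : ℝ → ℂ} (hW : IntervalIntegrable W volume 0 1) (ρ : ℂ) :
    ‖ρ * sinTransform W ρ‖ ≤ (∫ u in (0 : ℝ)..1, ‖W u‖) * Real.exp |ρ.im| := by
  rw [mul_sinTransform, ← intervalIntegral.integral_mul_const]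
  refine intervalIntegral.norm_integral_le_of_norm_le zero_le_one ?_ (hW.norm.mul_const _)
  refine Eventually.of_forall fun u hu => ?_
  rw [norm_mul]
  gcongr
  exact (norm_sin_le _).trans (Real.exp_le_exp.2 (abs_im_mul_le ⟨hu.1.le, hu.2⟩))

theorem hasDerivAt_integral_mul_sin {W : ℝ → ℂ} (hW : IntervalIntegrable W volume 0 1) (ρ : ℂ) :
    HasDerivAt (fun ρ => ∫ u in (0 : ℝ)..1, W u * Complex.sin (ρ * u))
      (∫ u in (0 : ℝ)..1, W u * (Complex.cos (ρ * u) * u)) ρ := by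
  have hm : AEStronglyMeasurable W (volume.restrict (uIoc (0 : ℝ) 1)) :=
    hW.aestronglyMeasurable_restrict_uIoc
  refine (intervalIntegral.hasDerivAt_integral_of_dominated_loc_of_deriv_le
    (F' := fun ρ u => W u * (Complex.cos (ρ * u) * u))
    (bound := fun u => ‖W u‖ * Real.exp (|ρ.im| + 1)) (Metric.ball_mem_nhds ρ one_pos)
    (Eventually.of_forall fun z => hm.mul
      (by fun_prop : Continuous fun u : ℝ => Complex.sin (z * u)).aestronglyMeasurable)
    (hW.mul_continuousOn (by fun_prop : Continuous fun u : ℝ => Complex.sin (ρ * u)).continuousOn)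
    (hm.mul (by fun_prop : Continuous fun u : ℝ => Complex.cos (ρ * u) * u).aestronglyMeasurable) ?_ (hW.norm.mul_const _) ?_).2
  · refine Eventually.of_forall fun u hu z hz => ?_
    rw [uIoc_of_le zero_le_one] at hu
    have hu' : u ∈ Icc (0 : ℝ) 1 := ⟨hu.1.le, hu.2⟩
    rw [norm_mul, norm_mul]
    gcongr
    have h1 : ‖(u : ℂ)‖ ≤ 1 := by rw [Complex.norm_real, Real.norm_of_nonneg hu'.1]; exact hu'.2
    have h2 : |z.im| ≤ |ρ.im| + 1 := by
      have := (Complex.abs_im_le_norm (z - ρ)).trans (mem_ball_iff_norm.1 hz).le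
      rw [Complex.sub_im] at this
      have := abs_sub_abs_le_abs_sub z.im ρ.im
      linarith
    calc ‖Complex.cos (z * u)‖ * ‖(u : ℂ)‖ ≤ ‖Complex.cos (z * u)‖ * 1 := by gcongr
      _ ≤ Real.exp (|ρ.im| + 1) := by
        rw [mul_one]
        exact (norm_cos_le _).trans (Real.exp_le_exp.2 ((abs_im_mul_le hu').trans h2))
  · refine Eventually.of_forall fun u hu z hz => ?_
    have := ((hasDerivAt_id z).mul_const (u : ℂ)).csin
    simpa using this.const_mul (W u)

/-- Exhibits the singularity at `ρ = 0` as removable: the difference quotient at `0` of an entire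
function is entire. -/
theorem sinTransform_eq_dslope {W : ℝ → ℂ} (hW : IntervalIntegrable W volume 0 1) :
    sinTransform W = dslope (fun ρ => ∫ u in (0 : ℝ)..1, W u * Complex.sin (ρ * u)) 0 := by
  funext ρ
  by_cases h : ρ = 0
  · rw [h, dslope_same, (hasDerivAt_integral_mul_sin hW 0).deriv, sinTransform]
    congr 1 with u
    simp [sinOver]
  · rw [dslope_of_ne _ h, slope_def_field, ← mul_sinTransform]
    simp [h]

theorem differentiable_sinTransform {W : ℝ → ℂ} (hW : IntervalIntegrable W volume 0 1) :
    Differentiable ℂ (sinTransform W) := by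
  rw [sinTransform_eq_dslope hW, ← differentiableOn_univ,
    Complex.differentiableOn_dslope univ_mem, differentiableOn_univ]
  exact fun ρ => (hasDerivAt_integral_mul_sin hW ρ).differentiableAt

theorem sinOver_neg_left (ρ z : ℂ) : sinOver (-ρ) z = sinOver ρ z := by
  unfold sinOver; simp [neg_div_neg_eq]

theorem sinTransform_neg (W : ℝ → ℂ) (ρ : ℂ) : sinTransform W (-ρ) = sinTransform W ρ := by
  simp [sinTransform, sinOver_neg_left]

/-- Take `g(z) = f(√z)`. Evenness makes the choice of the root irrelevant, so the branch cut is
harmless, and the origin is a removable singularity by continuity. -/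
theorem exists_differentiable_apply_sq {f : ℂ → ℂ} (hf : Differentiable ℂ f)
    (heven : ∀ ρ, f (-ρ) = f ρ) : ∃ g : ℂ → ℂ, Differentiable ℂ g ∧ ∀ ρ, g (ρ ^ 2) = f ρ := by
  have hsq : ∀ z : ℂ, (z ^ (2⁻¹ : ℂ)) ^ 2 = z := fun z => by
    exact_mod_cast Complex.cpow_nat_inv_pow z two_ne_zero
  have hext : ∀ s t : ℂ, s ^ 2 = t ^ 2 → f s = f t := fun s t h => by
    rcases sq_eq_sq_iff_eq_or_eq_neg.1 h with h | h
    · rw [h]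
    · rw [h, heven]
  refine ⟨fun z => f (z ^ (2⁻¹ : ℂ)), ?_, fun ρ => hext _ _ (hsq _)⟩
  have hne : ∀ z : ℂ, z ≠ 0 → DifferentiableAt ℂ (fun z => f (z ^ (2⁻¹ : ℂ))) z := by
    intro z hz
    -- Near `w = z` the quotient `w / z` is close to `1`, away from the cut of the principal root.
    have heq : (fun w => f (w ^ (2⁻¹ : ℂ))) =
        fun w => f (z ^ (2⁻¹ : ℂ) * (w / z) ^ (2⁻¹ : ℂ)) := by
      funext w
      apply hext
      rw [mul_pow, hsq, hsq, hsq]; field_simp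
    rw [heq]
    refine (hf _).comp z (DifferentiableAt.const_mul ?_ _)
    refine DifferentiableAt.cpow_const (by fun_prop) ?_
    simp [hz]
  intro z
  by_cases hz : z = 0
  · subst hz
    refine (Complex.analyticAt_of_differentiable_on_punctured_nhds_of_continuousAt ?_ ?_).differentiableAt
    · filter_upwards [self_mem_nhdsWithin] with w hw using hne w hw
    · refine hf.continuous.continuousAt.comp ?_
      exact Complex.continuousAt_cpow_const_of_re_pos (by simp) (by simp)
  · exact hne z hz

theorem exists_entire_charFunction (γ : ℂ) {W : ℝ → ℂ} (hW : IntervalIntegrable W volume 0 1) :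
    ∃ Δ : ℂ → ℂ, Differentiable ℂ Δ ∧
      ∀ ρ, Δ (ρ ^ 2) = 1 + γ ^ 2 - 2 * γ * Complex.cos ρ - sinTransform W ρ :=
  exists_differentiable_apply_sq
    (((Complex.differentiable_cos.const_mul (2 * γ)).const_sub _).sub
      (differentiable_sinTransform hW)) fun ρ => by simp [sinTransform_neg]

theorem exists_sq_eq (μ : ℂ) : ∃ ρ : ℂ, ρ ^ 2 = μ :=
  IsAlgClosed.exists_pow_nat_eq μ zero_lt_two

/-! ### Orders of zeros of perturbed products -/

/-- If `f` had the smaller order `m`, division by `‖z - μ‖ ^ m` and `z → μ` would make the leading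
coefficient of `f` vanish. -/
theorem analyticOrderAt_le_of_norm_le {f g : ℂ → ℂ} {μ : ℂ} {C : ℝ} (hf : AnalyticAt ℂ f μ)
    (hg : AnalyticAt ℂ g μ) (h : ∀ᶠ z in 𝓝[≠] μ, ‖f z‖ ≤ C * ‖g z‖) :
    analyticOrderAt g μ ≤ analyticOrderAt f μ := by
  by_contra! hlt
  obtain ⟨m, hm⟩ := ENat.ne_top_iff_exists.1 hlt.ne_top
  rw [← hm] at hlt
  obtain ⟨F, hFa, hF, hfF⟩ := (hf.analyticOrderAt_eq_natCast).1 hm.symm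
  have hle : ((m + 1 : ℕ) : ℕ∞) ≤ analyticOrderAt g μ := by
    push_cast; exact Order.add_one_le_of_lt hlt
  obtain ⟨G, hGa, hgG⟩ := (natCast_le_analyticOrderAt hg).1 hle
  have key : ∀ᶠ z in 𝓝[≠] μ, ‖F z‖ ≤ C * (‖z - μ‖ * ‖G z‖) := by
    filter_upwards [h, hfF.filter_mono nhdsWithin_le_nhds, hgG.filter_mono nhdsWithin_le_nhds,
      self_mem_nhdsWithin] with z h1 h2 h3 hz
    rw [h2, h3, smul_eq_mul, smul_eq_mul, norm_mul, norm_mul, norm_pow, norm_pow, pow_succ] at h1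
    have hpos : 0 < ‖z - μ‖ ^ m := pow_pos (norm_pos_iff.2 (sub_ne_zero.2 hz)) m
    refine le_of_mul_le_mul_left ?_ hpos
    linarith
  have t1 : Tendsto (fun z => ‖F z‖) (𝓝[≠] μ) (𝓝 ‖F μ‖) :=
    hFa.continuousAt.norm.tendsto.mono_left nhdsWithin_le_nhds
  have t2 : Tendsto (fun z => C * (‖z - μ‖ * ‖G z‖)) (𝓝[≠] μ) (𝓝 (C * (‖μ - μ‖ * ‖G μ‖))) := by
    have : ContinuousAt (fun z => C * (‖z - μ‖ * ‖G z‖)) μ := by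
      have := hGa.continuousAt
      fun_prop
    exact this.tendsto.mono_left nhdsWithin_le_nhds
  have := le_of_tendsto_of_tendsto t1 t2 key
  simp only [sub_self, norm_zero, zero_mul, mul_zero, norm_le_zero_iff] at this
  exact hF this

/-- A relative error `1/2` bounds each function by a constant multiple of the other, so neither
order can exceed the other. -/
theorem analyticOrderAt_eq_of_norm_sub_le {f g : ℂ → ℂ} {μ : ℂ} (hf : AnalyticAt ℂ f μ)
    (hg : AnalyticAt ℂ g μ) (h : ∀ᶠ z in 𝓝[≠] μ, ‖f z - g z‖ ≤ 1 / 2 * ‖g z‖) :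
    analyticOrderAt f μ = analyticOrderAt g μ := by
  apply le_antisymm
  · refine analyticOrderAt_le_of_norm_le (C := 2) hg hf (h.mono fun z hz => ?_)
    have := norm_sub_norm_le (g z) (f z)
    rw [norm_sub_rev] at this; linarith
  · refine analyticOrderAt_le_of_norm_le (C := 3 / 2) hf hg (h.mono fun z hz => ?_)
    have := norm_sub_norm_le (f z) (g z)
    linarith

section Product

variable {ι : Type*} {l κ : ι → ℂ}

/-- The factor `(z - l n - κ n) / (z - l n)` which moves a zero from `l n` to `l n + κ n`. -/
def shiftFactor (l κ : ι → ℂ) (z : ℂ) (n : ι) : ℂ := 1 - κ n / (z - l n)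

theorem shiftFactor_mul {z : ℂ} {n : ι} (h : z ≠ l n) :
    shiftFactor l κ z n * (z - l n) = z - (l n + κ n) := by
  have : z - l n ≠ 0 := sub_ne_zero.2 h
  rw [shiftFactor]; field_simp; ring

theorem norm_prod_shiftFactor_le (s : Finset ι) (z : ℂ) :
    ‖∏ n ∈ s, shiftFactor l κ z n‖ ≤ Real.exp (∑ n ∈ s, ‖κ n / (z - l n)‖) := by
  rw [norm_prod, Real.exp_sum]
  refine Finset.prod_le_prod (fun _ _ => norm_nonneg _) fun n _ => ?_
  refine (norm_sub_le _ _).trans ?_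
  rw [norm_one, add_comm]
  exact Real.add_one_le_exp _

theorem multipliable_shiftFactor {z : ℂ} (h : Summable fun n => ‖κ n / (z - l n)‖) :
    Multipliable (shiftFactor l κ z) := by
  have := multipliable_one_add_of_summable (R := ℂ) (f := fun n => -(κ n / (z - l n)))
    (by simpa using h)
  refine this.congr fun n => ?_
  rw [shiftFactor, ← sub_eq_add_neg]

/-- Outside a finite set of indices the points `l n` keep distance at least `2` from `μ`, and the
tail of the sum is small. For `z` in the unit disc around `μ` the distance to `l n` drops at most by
half, so every finite product over the tail stays close to `1`. -/
theorem exists_finset_prod_shiftFactor (μ : ℂ) (h : Summable fun n => ‖κ n / (μ - l n)‖)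
    (hl : Tendsto (fun n => ‖l n‖) cofinite atTop) :
    ∃ s : Finset ι, (∀ n, l n = μ → n ∈ s) ∧ (∀ n, l n + κ n = μ → n ∈ s) ∧
      ∀ᶠ z in 𝓝 μ, (∀ n, z = l n → n ∈ s) ∧ ∀ t : Finset ι, Disjoint t s →
        ‖∏ n ∈ t, shiftFactor l κ z n - 1‖ ≤ 1 / 2 := by
  classical
  -- The tail at most doubles when `μ` is replaced by `z`, and `exp (1 / 4) ≤ 3 / 2`.
  obtain ⟨s₁, hs₁⟩ := summable_iff_vanishing_norm.1 h (1 / 8) (by norm_num)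
  have hfin : {n | ¬ (‖μ‖ + 2 ≤ ‖l n‖)}.Finite := hl.eventually_ge_atTop _
  have hfar : ∀ n, n ∉ s₁ ∪ hfin.toFinset → 2 ≤ ‖μ - l n‖ := fun n hn => by
    simp only [Finset.mem_union, Finite.mem_toFinset, mem_ofPred_eq, not_or, not_not] at hn
    have := norm_sub_norm_le (l n) μ
    rw [norm_sub_rev] at this
    linarith [hn.2]
  refine ⟨s₁ ∪ hfin.toFinset, fun n hn => ?_, fun n hn => ?_, ?_⟩
  · by_contra hc
    have := hfar n hc
    rw [hn] at this; norm_num at this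
  · by_contra hc
    have h1 := hfar n hc
    -- If `l n + κ n = μ`, this single term of the tail equals `1`.
    have h2 := hs₁ {n} (by
      rw [Finset.disjoint_singleton_left]; exact fun h => hc (Finset.mem_union_left _ h))
    have h3 : κ n = μ - l n := by rw [← hn]; ring
    have h4 : μ - l n ≠ 0 := norm_pos_iff.1 (by linarith)
    rw [Finset.sum_singleton, h3, div_self h4] at h2
    norm_num at h2
  · filter_upwards [Metric.ball_mem_nhds μ one_pos] with z hz
    have hzn : ∀ n, n ∉ s₁ ∪ hfin.toFinset → ‖μ - l n‖ / 2 ≤ ‖z - l n‖ := fun n hn => by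
      have h1 := hfar n hn
      have h2 := norm_sub_norm_le (μ - l n) (μ - z)
      rw [sub_sub_sub_cancel_left] at h2
      have h3 : ‖μ - z‖ < 1 := by rw [← dist_eq_norm, dist_comm]; exact hz
      linarith
    refine ⟨fun n hn => ?_, fun t ht => ?_⟩
    · by_contra hc
      have h1 := hzn n hc
      have h2 := hfar n hc
      rw [hn, sub_self, norm_zero] at h1
      linarith
    have hn : ∀ n ∈ t, n ∉ s₁ ∪ hfin.toFinset := fun n hn => Finset.disjoint_left.1 ht hn
    have e1 : ∑ n ∈ t, ‖-(κ n / (z - l n))‖ ≤ 2 * ∑ n ∈ t, ‖κ n / (μ - l n)‖ := by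
      rw [Finset.mul_sum]
      refine Finset.sum_le_sum fun n hnt => ?_
      have h1 := hzn n (hn n hnt)
      have h2 := hfar n (hn n hnt)
      rw [norm_neg, norm_div, norm_div, ← mul_div_assoc,
        div_le_div_iff₀ (by linarith) (by linarith)]
      nlinarith [norm_nonneg (κ n)]
    have e2 : ∑ n ∈ t, ‖κ n / (μ - l n)‖ < 1 / 8 := by
      have := hs₁ t (Finset.disjoint_of_subset_right Finset.subset_union_left ht)
      rwa [Real.norm_of_nonneg (Finset.sum_nonneg fun _ _ => norm_nonneg _)] at this
    have e3 := Finset.norm_prod_one_add_sub_one_le t fun n => -(κ n / (z - l n))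
    have e4 : Real.exp (∑ n ∈ t, ‖-(κ n / (z - l n))‖) ≤ 1 + 1 / 2 := by
      refine (Real.exp_le_exp.2 (by linarith : _ ≤ (1 / 4 : ℝ))).trans ?_
      have := Real.exp_bound_div_one_sub_of_interval (x := 1 / 4) (by norm_num) (by norm_num)
      norm_num at this ⊢; linarith
    simp only [← sub_eq_add_neg] at e3
    exact e3.trans (by linarith)

theorem norm_tprod_shiftFactor_sub_le {z : ℂ} {s : Finset ι}
    (hm : Multipliable (shiftFactor l κ z))
    (h : ∀ t : Finset ι, Disjoint t s → ‖∏ n ∈ t, shiftFactor l κ z n - 1‖ ≤ 1 / 2) :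
    ‖∏' n, shiftFactor l κ z n - ∏ n ∈ s, shiftFactor l κ z n‖ ≤
      1 / 2 * ‖∏ n ∈ s, shiftFactor l κ z n‖ := by
  classical
  have ht := (hm.hasProd.sub_const (∏ n ∈ s, shiftFactor l κ z n)).norm
  refine le_of_tendsto ht ?_
  filter_upwards [eventually_ge_atTop s] with t hts
  rw [← Finset.prod_sdiff hts]
  have := h (t \ s) Finset.sdiff_disjoint
  rw [show ∀ a b : ℂ, a * b - b = (a - 1) * b from fun a b => by ring, norm_mul]
  gcongr

theorem analyticOrderAt_prod_sub (s : Finset ι) (f : ι → ℂ) (μ : ℂ) [DecidablePred fun n => f n = μ] :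
    analyticOrderAt (fun z => ∏ n ∈ s, (z - f n)) μ = (s.filter fun n => f n = μ).card := by
  classical
  induction s using Finset.induction_on with
  | empty =>
    simp only [Finset.prod_empty, Finset.filter_empty, Finset.card_empty, Nat.cast_zero]
    exact (analyticAt_const.analyticOrderAt_eq_zero).2 one_ne_zero
  | insert a s ha ih =>
    have : (fun z => ∏ n ∈ insert a s, (z - f n)) =
        (fun z => z - f a) * fun z => ∏ n ∈ s, (z - f n) := by
      funext z; simp [Finset.prod_insert ha]
    rw [this, analyticOrderAt_mul (by fun_prop) (by fun_prop), ih, Finset.filter_insert]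
    split_ifs with h
    · have h1 : analyticOrderAt (fun z => z - f a) μ = 1 := by
        rw [← h]; exact analyticOrderAt_id_sub_const_self
      rw [Finset.card_insert_of_notMem (by simp [ha]), h1]
      push_cast
      rw [add_comm]
    · have : analyticOrderAt (fun z => z - f a) μ = 0 := by
        refine AnalyticAt.analyticOrderAt_eq_zero (by fun_prop) |>.2 (sub_ne_zero.2 (Ne.symm h))
      rw [this, zero_add]

/-- Analyticity of the infinite product is not needed. Near `μ` the product is, up to relative error
`1/2`, the finite product over `s`; clearing denominators, `Δ ∏ (z - l n)` and `Δ₀ ∏ (z - (l n + κ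
n))` have the same order at `μ`. The order of `Δ₀` then cancels against the first finite product. -/
theorem analyticOrderAt_of_eq_mul_tprod {Δ Δ₀ : ℂ → ℂ} (hΔ : Differentiable ℂ Δ)
    (hΔ₀ : Differentiable ℂ Δ₀) (h : ∀ z, Summable fun n => ‖κ n / (z - l n)‖)
    (hl : Tendsto (fun n => ‖l n‖) cofinite atTop)
    (heq : ∀ z, (∀ n, z ≠ l n) → Δ z = Δ₀ z * ∏' n, shiftFactor l κ z n) (μ : ℂ)
    (hord : analyticOrderAt Δ₀ μ = {n | l n = μ}.encard) :
    analyticOrderAt Δ μ = {n | l n + κ n = μ}.encard := by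
  classical
  obtain ⟨s, hs1, hs2, hs3⟩ := exists_finset_prod_shiftFactor μ (h μ) hl
  have hfar : ∀ᶠ z in 𝓝[≠] μ, ∀ n ∈ s, z ≠ l n := by
    rw [Filter.eventually_all_finset]
    intro n _
    by_cases hn : l n = μ
    · rw [hn]; exact self_mem_nhdsWithin
    · exact nhdsWithin_le_nhds (isOpen_ne.mem_nhds (Ne.symm hn))
  have hA : ∀ f : ι → ℂ, AnalyticAt ℂ (fun z => ∏ n ∈ s, (z - f n)) μ := fun f => by fun_prop
  have key := analyticOrderAt_eq_of_norm_sub_le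
    (f := Δ * fun z => ∏ n ∈ s, (z - l n)) (g := Δ₀ * fun z => ∏ n ∈ s, (z - (l n + κ n))) (μ := μ)
    ((hΔ.analyticAt μ).mul (hA l)) ((hΔ₀.analyticAt μ).mul (hA _)) (by
      filter_upwards [hfar, hs3.filter_mono nhdsWithin_le_nhds] with z hz hz3
      have hzn : ∀ n, z ≠ l n := fun n hn => hz n (hz3.1 n hn) hn
      have e1 := norm_tprod_shiftFactor_sub_le (multipliable_shiftFactor (h z)) hz3.2
      have e2 : ∏ n ∈ s, (z - (l n + κ n)) =
          (∏ n ∈ s, shiftFactor l κ z n) * ∏ n ∈ s, (z - l n) := by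
        rw [← Finset.prod_mul_distrib]
        exact Finset.prod_congr rfl fun n _ => (shiftFactor_mul (hzn n)).symm
      simp only [Pi.mul_apply]
      rw [heq z hzn, e2]
      set B := ∏ n ∈ s, (z - l n)
      set p := ∏ n ∈ s, shiftFactor l κ z n
      set P := ∏' n, shiftFactor l κ z n
      rw [show Δ₀ z * P * B - Δ₀ z * (p * B) = (Δ₀ z * B) * (P - p) by ring,
        show Δ₀ z * (p * B) = (Δ₀ z * B) * p by ring, norm_mul, norm_mul (Δ₀ z * B) p]
      nlinarith [norm_nonneg (Δ₀ z * B)])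
  rw [analyticOrderAt_mul (hΔ.analyticAt μ) (hA l),
    analyticOrderAt_mul (hΔ₀.analyticAt μ) (hA _), hord, analyticOrderAt_prod_sub,
    analyticOrderAt_prod_sub] at key
  have c : ∀ f : ι → ℂ, (∀ n, f n = μ → n ∈ s) →
      {n | f n = μ}.encard = ((s.filter fun n => f n = μ).card : ℕ∞) := fun f hf => by
    rw [← Set.encard_coe_eq_coe_finsetCard]
    congr 1 with n
    simp only [mem_ofPred_eq, Finset.coe_filter]
    exact ⟨fun h => ⟨hf n h, h⟩, fun h => h.2⟩
  rw [c l hs1, add_comm (analyticOrderAt Δ μ)] at key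
  rw [c _ hs2]
  exact ENat.add_right_injective_of_ne_top (by simp) key

/-! ### Partial fractions -/

/-- The residue at `l n` of the finite product of shift factors over `s`. -/
def shiftResidue [DecidableEq ι] (l κ : ι → ℂ) (s : Finset ι) (n : ι) : ℂ :=
  -κ n * ∏ m ∈ s.erase n, shiftFactor l κ (l n) m

/-- The poles are simple because the points `l n` with `κ n ≠ 0` are distinct; indices with `κ n =
0` contribute the factor `1` and may repeat points. The induction splits each cross term `1/((z - l
n)(z - l a))`. -/
theorem prod_shiftFactor_eq [DecidableEq ι]
    (hinj : ∀ n m, κ n ≠ 0 → κ m ≠ 0 → n ≠ m → l n ≠ l m) (s : Finset ι) :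
    ∀ z : ℂ, (∀ n ∈ s, κ n ≠ 0 → z ≠ l n) →
      ∏ n ∈ s, shiftFactor l κ z n = 1 + ∑ n ∈ s, shiftResidue l κ s n / (z - l n) := by
  induction s using Finset.induction_on with
  | empty => simp
  | insert a s ha ih =>
    intro z hz
    have hne : ∀ n ∈ s, n ≠ a := fun n hn h => ha (h ▸ hn)
    have hz' : ∀ n ∈ s, κ n ≠ 0 → z ≠ l n := fun n hn => hz n (Finset.mem_insert_of_mem hn)
    have hres : ∀ n ∈ s, shiftResidue l κ (insert a s) n =
        shiftResidue l κ s n * shiftFactor l κ (l n) a := fun n hn => by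
      rw [shiftResidue, Finset.erase_insert_of_ne (hne n hn).symm,
        Finset.prod_insert (by simp [ha]), shiftResidue]; ring
    rw [Finset.prod_insert ha, Finset.sum_insert ha, ih z hz']
    by_cases hκ : κ a = 0
    · have e1 : shiftResidue l κ (insert a s) a = 0 := by simp [shiftResidue, hκ]
      have e2 : ∀ w, shiftFactor l κ w a = 1 := fun w => by simp [shiftFactor, hκ]
      rw [e1, e2, zero_div, zero_add, one_mul]
      congr 1
      exact Finset.sum_congr rfl fun n hn => by rw [hres n hn, e2, mul_one]
    · have hza : z - l a ≠ 0 := sub_ne_zero.2 (hz a (Finset.mem_insert_self a s) hκ)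
      have e1 : shiftResidue l κ (insert a s) a =
          -κ a * (1 + ∑ n ∈ s, shiftResidue l κ s n / (l a - l n)) := by
        rw [shiftResidue, Finset.erase_insert ha,
          ih (l a) fun n hn hn0 => hinj a n hκ hn0 (hne n hn).symm]
      rw [e1, mul_add (shiftFactor l κ z a), mul_one, Finset.mul_sum, mul_add (-κ a), add_div,
        Finset.mul_sum, Finset.sum_div, add_assoc, ← Finset.sum_add_distrib, mul_one,
        ← add_assoc, shiftFactor, neg_div, ← sub_eq_add_neg]
      congr 1
      refine Finset.sum_congr rfl fun n hn => ?_
      rw [hres n hn]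
      by_cases hn0 : κ n = 0
      · simp [shiftResidue, hn0]
      · have h1 : z - l n ≠ 0 := sub_ne_zero.2 (hz' n hn hn0)
        have h2 : l a - l n ≠ 0 := sub_ne_zero.2 (hinj a n hκ hn0 (hne n hn).symm)
        have h3 : l n - l a ≠ 0 := sub_ne_zero.2 (hinj n a hn0 hκ (hne n hn))
        have h4 : l n - l a = -(l a - l n) := by ring
        rw [shiftFactor, h4]
        field_simp
        ring

/-- The bound `K` controls the products in all finite residues by `exp K`, uniformly in the finite
set. This dominates the finite expansions, and the limit residues inherit the decay of `κ`. -/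
theorem exists_tprod_shiftFactor_eq (hinj : ∀ n m, κ n ≠ 0 → κ m ≠ 0 → n ≠ m → l n ≠ l m)
    (h : ∀ z, Summable fun n => ‖κ n / (z - l n)‖) {K : ℝ}
    (hK : ∀ n, κ n ≠ 0 → ∀ s : Finset ι, ∑ m ∈ s, ‖κ m / (l n - l m)‖ ≤ K) :
    ∃ b : ι → ℂ, (∀ n, ‖b n‖ ≤ Real.exp K * ‖κ n‖) ∧
      ∀ z, (∀ n, z ≠ l n) → HasSum (fun n => b n / (z - l n)) (∏' n, shiftFactor l κ z n - 1) := by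
  classical
  have hbd : ∀ s n, ‖shiftResidue l κ s n‖ ≤ Real.exp K * ‖κ n‖ := fun s n => by
    by_cases hn : κ n = 0
    · simp [shiftResidue, hn]
    rw [shiftResidue, norm_mul, norm_neg, mul_comm]
    gcongr
    exact (norm_prod_shiftFactor_le _ _).trans (Real.exp_le_exp.2 (hK n hn _))
  have hlim : ∀ n, ∃ b, Tendsto (fun s => shiftResidue l κ s n) atTop (𝓝 b) := fun n => by
    have hm := (multipliable_shiftFactor (h (l n))).hasProd
    -- the factor at `n` itself is `1` because division by zero gives zero
    have h1 : shiftFactor l κ (l n) n = 1 := by simp [shiftFactor]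
    refine ⟨-κ n * ∏' m, shiftFactor l κ (l n) m, Tendsto.const_mul _ ?_⟩
    refine hm.congr fun s => ?_
    by_cases hns : n ∈ s
    · rw [← Finset.mul_prod_erase s _ hns, h1, one_mul]
    · rw [Finset.erase_eq_of_notMem hns]
  choose b hb using hlim
  have hbn : ∀ n, ‖b n‖ ≤ Real.exp K * ‖κ n‖ := fun n =>
    le_of_tendsto (hb n).norm (Eventually.of_forall fun s => hbd s n)
  refine ⟨b, hbn, fun z hz => ?_⟩
  have hbound : Summable fun n => Real.exp K * ‖κ n / (z - l n)‖ := (h z).mul_left _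
  have hsum : Summable fun n => b n / (z - l n) := by
    refine Summable.of_norm_bounded hbound fun n => ?_
    rw [norm_div, norm_div, ← mul_div_assoc]
    gcongr
    exact hbn n
  rw [hsum.hasSum_iff]
  -- Extending the finite sums by zero makes them series over one index set, to which dominated
  -- convergence applies.
  have t1 : Tendsto (fun s : Finset ι => ∑' n, (s : Set ι).indicator
      (fun n => shiftResidue l κ s n / (z - l n)) n) atTop (𝓝 (∑' n, b n / (z - l n))) := by
    refine tendsto_tsum_of_dominated_convergence hbound (fun n => ?_) (Eventually.of_forall fun s n => ?_)
    · refine ((hb n).div_const _).congr' ?_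
      filter_upwards [eventually_ge_atTop {n}] with s hs
      rw [indicator_of_mem (by simpa using hs)]
    · refine (norm_indicator_le_norm_self _ _).trans ?_
      rw [norm_div, norm_div, ← mul_div_assoc]
      gcongr
      exact hbd s n
  have t2 := (multipliable_shiftFactor (h z)).hasProd.sub_const 1
  refine tendsto_nhds_unique (t1.congr fun s => ?_) t2
  rw [prod_shiftFactor_eq hinj s z fun n _ _ => hz n, add_sub_cancel_left,
    tsum_eq_sum (s := s) fun n hn => indicator_of_notMem (by simpa using hn) _]
  exact Finset.sum_congr rfl fun n hn => indicator_of_mem (by simpa using hn) _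

end Product

/-! ### Cosine series in `L₂(0,1)` and their sine transforms -/

theorem integral_unitMeasure (f : ℝ → ℂ) : ∫ x, f x ∂unitMeasure = ∫ x in (0 : ℝ)..1, f x := by
  rw [intervalIntegral.integral_of_le zero_le_one, ← restrict_Ioo_eq_restrict_Ioc]

/-- The exponential `exp (2 π i k x)`. -/
def expFun (k : ℤ) (x : ℝ) : ℂ := Complex.exp (2 * Real.pi * Complex.I * k * x)

@[fun_prop]
theorem continuous_expFun (k : ℤ) : Continuous (expFun k) := by unfold expFun; fun_prop

theorem memLp_expFun (k : ℤ) : MemLp (expFun k) 2 unitMeasure :=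
  memLp_of_continuousOn (continuous_expFun k).continuousOn

/-- The exponentials as elements of `L₂(0,1)`. -/
def expL2 (k : ℤ) : L2 := (memLp_expFun k).toLp _

theorem integral_expFun (k : ℤ) : ∫ x in (0 : ℝ)..1, expFun k x = if k = 0 then 1 else 0 := by
  unfold expFun
  split_ifs with h
  · simp [h]
  · have hc : (2 * Real.pi * Complex.I * k : ℂ) ≠ 0 := by
      simp [Real.pi_ne_zero, h]
    rw [integral_exp_mul_complex hc]
    have : Complex.exp (2 * Real.pi * Complex.I * k * (1 : ℝ)) = 1 :=
      Complex.exp_eq_one_iff.2 ⟨k, by push_cast; ring⟩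
    rw [this]; simp

theorem orthonormal_expL2 : Orthonormal ℂ expL2 := by
  rw [orthonormal_iff_ite]
  intro j k
  rw [L2.inner_def]
  have : ∀ᵐ x ∂unitMeasure, inner ℂ (expL2 j x) (expL2 k x) = expFun (k - j) x := by
    filter_upwards [(memLp_expFun j).coeFn_toLp, (memLp_expFun k).coeFn_toLp] with x hj hk
    rw [expL2, expL2, hj, hk, RCLike.inner_apply, expFun, expFun, expFun, ← Complex.exp_conj,
      ← Complex.exp_add]
    congr 1
    simp only [map_mul, Complex.conj_I, Complex.conj_ofReal, map_ofNat, map_intCast]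
    push_cast; ring
  rw [integral_congr_ae this, integral_unitMeasure, integral_expFun]
  simp only [sub_eq_zero, eq_comm]

theorem exists_hasSum_expL2 {b : ℤ → ℂ} (hb : Summable fun k => ‖b k‖ ^ 2) :
    ∃ F : L2, HasSum (fun k => b k • expL2 k) F := by
  have := (orthonormal_expL2.orthogonalFamily.summable_iff_norm_sq_summable b).2 hb
  exact ⟨_, this.hasSum⟩

theorem inner_toLp_conj {g : ℝ → ℂ} (hg : MemLp (fun x => (starRingEnd ℂ) (g x)) 2 unitMeasure)
    (F : L2) : inner ℂ (hg.toLp _) F = ∫ x in (0 : ℝ)..1, F x * g x := by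
  rw [L2.inner_def, ← integral_unitMeasure]
  refine integral_congr_ae ?_
  filter_upwards [hg.coeFn_toLp] with x hx
  rw [hx, RCLike.inner_apply]; simp

/-- Integration against `g` is the inner product with the conjugate of `g`, a continuous functional,
so the series may be integrated termwise. -/
theorem hasSum_integral_mul {b : ℤ → ℂ} {F : L2} (hF : HasSum (fun k => b k • expL2 k) F)
    {g : ℝ → ℂ} (hg : Continuous g) :
    HasSum (fun k => b k * ∫ x in (0 : ℝ)..1, expFun k x * g x) (∫ x in (0 : ℝ)..1, F x * g x) := by
  have hm : MemLp (fun x => (starRingEnd ℂ) (g x)) 2 unitMeasure :=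
    memLp_of_continuousOn (Complex.continuous_conj.comp hg).continuousOn
  have := hF.mapL (innerSL ℂ (hm.toLp _))
  rw [innerSL_apply_apply, inner_toLp_conj] at this
  have e : ∀ k, innerSL ℂ (hm.toLp _) (b k • expL2 k) =
      b k * ∫ x in (0 : ℝ)..1, expFun k x * g x := fun k => by
    rw [map_smul, innerSL_apply_apply, inner_toLp_conj, smul_eq_mul, ← integral_unitMeasure,
      ← integral_unitMeasure]
    congr 1
    refine integral_congr_ae ?_
    filter_upwards [(memLp_expFun k).coeFn_toLp] with x hx
    rw [expL2, hx]
  simpa only [e] using this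

/-- This is what makes a simple fraction, multiplied by the unperturbed characteristic function, a
sine transform. The integrand has an explicit primitive. -/
theorem integral_cos_mul_sinOver {ρ r : ℂ} (h : ρ ^ 2 ≠ r ^ 2) :
    ∫ u in (0 : ℝ)..1, Complex.cos (r * (1 - u)) * sinOver ρ u =
      (Complex.cos r - Complex.cos ρ) / (ρ ^ 2 - r ^ 2) := by
  have hne : ρ ^ 2 - r ^ 2 ≠ 0 := sub_ne_zero.2 h
  have hd : ∀ u ∈ uIcc (0 : ℝ) 1, HasDerivAt (fun u : ℝ =>
      (r ^ 2 * sinOver r (1 - u) * sinOver ρ u - Complex.cos (r * (1 - u)) * Complex.cos (ρ * u)) /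
        (ρ ^ 2 - r ^ 2)) (Complex.cos (r * (1 - u)) * sinOver ρ u) u := fun u _ => by
    have h1 := hasDerivAt_sinOver_sub r 1 u
    have h2 := hasDerivAt_cos_sub r 1 u
    simp only [Complex.ofReal_one] at h1 h2
    have := ((((h1.const_mul (r ^ 2)).mul (hasDerivAt_sinOver_ofReal ρ u)).sub
      (h2.mul (hasDerivAt_cos_mul_ofReal ρ u))).div_const (ρ ^ 2 - r ^ 2))
    refine this.congr_deriv ?_
    field_simp; ring
  rw [intervalIntegral.integral_eq_sub_of_hasDerivAt hd
    (Continuous.intervalIntegrable (by fun_prop) _ _)]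
  simp
  ring

/-- The node `π (2 k + α)`. -/
def node (α : ℂ) (k : ℤ) : ℂ := Real.pi * (2 * k + α)

theorem cos_node (α : ℂ) (k : ℤ) : Complex.cos (node α k) = Complex.cos (Real.pi * α) := by
  rw [Complex.cos_eq_cos_iff]
  exact ⟨-k, Or.inl (by rw [node]; push_cast; ring)⟩

/-- The sum `∑ bₖ cos (π (2 k + α) (1 - u))`, expressed through `F = ∑ bₖ exp (2 π i k x)`. -/
def cosSeries (α : ℂ) (F : ℝ → ℂ) (u : ℝ) : ℂ :=
  (Complex.exp (Complex.I * Real.pi * α * (1 - u)) * F (1 - u) +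
    Complex.exp (-(Complex.I * Real.pi * α * (1 - u))) * F u) / 2

theorem memLp_continuous_mul {f g : ℝ → ℂ} (hf : Continuous f) (hg : MemLp g 2 unitMeasure) :
    MemLp (fun u => f u * g u) 2 unitMeasure := by
  obtain ⟨C, hC⟩ := isCompact_Icc.exists_bound_of_continuousOn (hf.continuousOn (s := Icc 0 1))
  refine MemLp.of_le_mul (c := C) hg (hf.aestronglyMeasurable.mul hg.1) ?_
  refine unitMeasure_ae_of_forall fun x hx => ?_
  rw [norm_mul]
  gcongr
  exact hC x (Ioo_subset_Icc_self hx)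

theorem memLp_cosSeries (α : ℂ) {F : ℝ → ℂ} (hF : MemLp F 2 unitMeasure) :
    MemLp (cosSeries α F) 2 unitMeasure := by
  have h1 := memLp_continuous_mul
    (f := fun u : ℝ => Complex.exp (Complex.I * Real.pi * α * (1 - u)) / 2) (by fun_prop)
    (memLp_comp_one_sub hF)
  have h2 := memLp_continuous_mul
    (f := fun u : ℝ => Complex.exp (-(Complex.I * Real.pi * α * (1 - u))) / 2) (by fun_prop) hF
  convert h1.add h2 using 1
  funext u
  simp only [cosSeries, Pi.add_apply]; ring

theorem integral_comp_one_sub (f : ℝ → ℂ) :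
    ∫ u in (0 : ℝ)..1, f (1 - u) = ∫ u in (0 : ℝ)..1, f u := by
  simp

/-- On the exponential with index `k` the operator `cosSeries` gives `cos(node α k · (1 - u))`,
whose transform is known; the cosines of all nodes have the common value `cos πα`. -/
theorem hasSum_sinTransform_cosSeries (α : ℂ) {b : ℤ → ℂ} {F : L2}
    (hF : HasSum (fun k => b k • expL2 k) F) {ρ : ℂ} (hρ : ∀ k, ρ ^ 2 ≠ node α k ^ 2) :
    HasSum (fun k => b k * ((Complex.cos (Real.pi * α) - Complex.cos ρ) / (ρ ^ 2 - node α k ^ 2)))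
      (sinTransform (cosSeries α F) ρ) := by
  set E : ℝ → ℂ := fun u => Complex.exp (Complex.I * Real.pi * α * u) with hE
  have hEc : Continuous E := by fun_prop
  set g₁ : ℝ → ℂ := fun u => E u * sinOver ρ (1 - u) with hg₁
  set g₂ : ℝ → ℂ := fun u => E (-(1 - u)) * sinOver ρ u with hg₂
  have c₁ : Continuous g₁ := by fun_prop
  have c₂ : Continuous g₂ := by fun_prop
  -- Moves `cosSeries` onto the test function by `u ↦ 1 - u`, so that the `L₂` series is paired with
  -- one fixed continuous function.
  have key : ∀ f : ℝ → ℂ, IntervalIntegrable f volume 0 1 →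
      (IntervalIntegrable (fun u => f (1 - u)) volume 0 1) →
      ∫ u in (0 : ℝ)..1, f u * ((g₁ u + g₂ u) / 2) = sinTransform (cosSeries α f) ρ := by
    intro f hf hf'
    have i1 : IntervalIntegrable (fun u => f u * g₁ u) volume 0 1 :=
      hf.mul_continuousOn c₁.continuousOn
    have i2 : IntervalIntegrable (fun u => f u * g₂ u) volume 0 1 :=
      hf.mul_continuousOn c₂.continuousOn
    have i1' : IntervalIntegrable (fun u => f (1 - u) * g₁ (1 - u)) volume 0 1 :=
      hf'.mul_continuousOn (by fun_prop : Continuous fun u => g₁ (1 - u)).continuousOn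
    calc _ = ∫ u in (0 : ℝ)..1, (f u * g₁ u + f u * g₂ u) / 2 := by
          congr 1 with u; ring
      _ = (∫ u in (0 : ℝ)..1, (f (1 - u) * g₁ (1 - u) + f u * g₂ u)) / 2 := by
          rw [intervalIntegral.integral_div, intervalIntegral.integral_add i1 i2,
            intervalIntegral.integral_add i1' i2, integral_comp_one_sub (fun u => f u * g₁ u)]
      _ = _ := by
          rw [← intervalIntegral.integral_div, sinTransform]
          congr 1 with u
          simp only [hg₁, hg₂, hE, cosSeries]
          push_cast
          rw [sub_sub_cancel, mul_neg]
          ring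
  have hFi := intervalIntegrable_of_memLp_two (Lp.memLp F)
  have hFi' := intervalIntegrable_of_memLp_two (memLp_comp_one_sub (Lp.memLp F))
  have := hasSum_integral_mul hF (g := fun u => (g₁ u + g₂ u) / 2) (by fun_prop)
  rw [key F hFi hFi'] at this
  convert this using 2 with k
  congr 1
  rw [key (expFun k) ((continuous_expFun k).intervalIntegrable _ _)
    (Continuous.intervalIntegrable (by fun_prop) _ _), ← cos_node α k,
    ← integral_cos_mul_sinOver (hρ k), sinTransform]
  congr 1 with u
  congr 1
  rw [cosSeries, Complex.cos, node, expFun, expFun, ← Complex.exp_add, ← Complex.exp_add]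
  -- The exponents differ by `2πik`.
  have hper : Complex.exp (-(Complex.I * Real.pi * α * (1 - u)) +
      2 * Real.pi * Complex.I * k * u) =
      Complex.exp (-(Real.pi * (2 * k + α) * (1 - u)) * Complex.I) := by
    rw [Complex.exp_eq_exp_iff_exists_int]
    exact ⟨k, by ring⟩
  rw [hper]
  congr 3
  push_cast; ring

/-- For `γ = ±1` this symmetry is the solvability condition of the folding equation `X(u) + γX(1 -
u) = W(u)`. -/
theorem cosSeries_one_sub {α γ : ℂ} (hγ : γ = 1 ∨ γ = -1)
    (hα : Complex.exp (Complex.I * Real.pi * α) = γ) (F : ℝ → ℂ) (u : ℝ) :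
    cosSeries α F (1 - u) = γ * cosSeries α F u := by
  have h1 : Complex.exp (Complex.I * Real.pi * α * (1 - u)) =
      γ * Complex.exp (-(Complex.I * Real.pi * α * u)) := by
    rw [← hα, ← Complex.exp_add]; ring_nf
  have h2 : Complex.exp (-(Complex.I * Real.pi * α * (1 - u))) =
      γ⁻¹ * Complex.exp (Complex.I * Real.pi * α * u) := by
    rw [← hα, ← Complex.exp_neg, ← Complex.exp_add]; ring_nf
  have h3 : γ * γ = 1 := by rcases hγ with h | h <;> simp [h]
  have h4 : γ⁻¹ = γ := inv_eq_of_mul_eq_one_left h3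
  rw [cosSeries, cosSeries, h1, h2, h4]
  push_cast
  rw [sub_sub_cancel, sub_sub_cancel]
  linear_combination (-(Complex.exp (-(Complex.I * Real.pi * α * u)) * F (1 - u)) / 2 -
    Complex.exp (Complex.I * Real.pi * α * u) * F u / 2) * h3

/-! ### Location and separation of the unperturbed eigenvalues -/

theorem norm_node_sq (α : ℂ) (k : ℤ) : ‖node α k ^ 2‖ = Real.pi ^ 2 * ‖(2 * k + α : ℂ)‖ ^ 2 := by
  rw [node, mul_pow, norm_mul, norm_pow, norm_pow, Complex.norm_real,
    Real.norm_of_nonneg Real.pi_pos.le]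

theorem tendsto_abs_intCast_cofinite : Tendsto (fun k : ℤ => |(k : ℝ)|) cofinite atTop := by
  simpa [Function.comp_def] using tendsto_norm_cocompact_atTop.comp Int.tendsto_coe_cofinite

theorem eventually_abs_le_norm_node_sq_sub (α z : ℂ) :
    ∀ᶠ k : ℤ in cofinite, |(k : ℝ)| ≤ ‖z - node α k ^ 2‖ := by
  filter_upwards [tendsto_abs_intCast_cofinite.eventually_ge_atTop (‖z‖ + ‖α‖ + 1)] with k hk
  have h1 : |(k : ℝ)| ≤ ‖(2 * k + α : ℂ)‖ := by
    have := norm_sub_norm_le (2 * k : ℂ) (-α)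
    rw [sub_neg_eq_add, norm_neg, norm_mul, Complex.norm_ofNat, Complex.norm_intCast] at this
    linarith [norm_nonneg z]
  have h2 := norm_sub_norm_le (node α k ^ 2) z
  rw [norm_sub_rev, norm_node_sq] at h2
  have h3 : (2 : ℝ) ≤ Real.pi ^ 2 := by nlinarith [Real.pi_gt_three]
  have h4 : |(k : ℝ)| ^ 2 ≤ ‖(2 * k + α : ℂ)‖ ^ 2 := by gcongr
  nlinarith [norm_nonneg z, norm_nonneg α]

theorem tendsto_norm_node_sq (α : ℂ) : Tendsto (fun k : ℤ => ‖node α k ^ 2‖) cofinite atTop := by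
  refine tendsto_atTop_mono' _ ?_ tendsto_abs_intCast_cofinite
  filter_upwards [eventually_abs_le_norm_node_sq_sub α 0] with k hk
  rwa [zero_sub, norm_neg] at hk

theorem norm_div_le_sq_add (x y : ℂ) : ‖x / y‖ ≤ ‖x‖ ^ 2 + 1 / ‖y‖ ^ 2 := by
  rw [norm_div, div_eq_mul_inv, one_div, ← inv_pow]
  nlinarith [sq_nonneg (‖x‖ - ‖y‖⁻¹), sq_nonneg ‖x‖, sq_nonneg ‖y‖⁻¹]

theorem summable_one_div_intCast_sq : Summable fun k : ℤ => 1 / |(k : ℝ)| ^ 2 := by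
  simpa using Real.summable_one_div_int_pow.2 one_lt_two

theorem summable_norm_div_sub_node_sq {α : ℂ} {κ : ℤ → ℂ} (hκ : Summable fun k => ‖κ k‖ ^ 2)
    (z : ℂ) : Summable fun k => ‖κ k / (z - node α k ^ 2)‖ := by
  refine Summable.of_norm_bounded_eventually (hκ.add summable_one_div_intCast_sq) ?_
  filter_upwards [eventually_abs_le_norm_node_sq_sub α z,
    tendsto_abs_intCast_cofinite.eventually_ge_atTop 1] with k hk hk1
  rw [norm_norm]
  refine (norm_div_le_sq_add _ _).trans ?_
  gcongr

/-- The nodes carrying a nonzero perturbation are uniformly separated. -/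
def Separated (α : ℂ) (κ : ℤ → ℂ) : Prop :=
  ∃ c > 0, ∀ k m : ℤ, κ k ≠ 0 → κ m ≠ 0 → c * |(k - m : ℝ)| ≤ ‖node α k ^ 2 - node α m ^ 2‖

theorem norm_node_sq_sub (α : ℂ) (k m : ℤ) : ‖node α k ^ 2 - node α m ^ 2‖ =
    4 * Real.pi ^ 2 * |(k - m : ℝ)| * ‖(((k + m : ℤ) : ℂ) + α)‖ := by
  have : node α k ^ 2 - node α m ^ 2 =
      ((4 * Real.pi ^ 2 * (k - m : ℝ) : ℝ) : ℂ) * (((k + m : ℤ) : ℂ) + α) := by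
    simp only [node]; push_cast; ring
  rw [this, norm_mul, Complex.norm_real, Real.norm_eq_abs, abs_mul,
    abs_of_pos (by positivity : 0 < 4 * Real.pi ^ 2)]

theorem separated_of_forall_le {α : ℂ} {κ : ℤ → ℂ} {c : ℝ} (hc : 0 < c)
    (h : ∀ k m : ℤ, κ k ≠ 0 → κ m ≠ 0 → k ≠ m → c ≤ ‖(((k + m : ℤ) : ℂ) + α)‖) :
    Separated α κ := by
  refine ⟨4 * Real.pi ^ 2 * c, by positivity, fun k m hk hm => ?_⟩
  by_cases hkm : k = m
  · simp [hkm]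
  · rw [norm_node_sq_sub, mul_right_comm]
    gcongr
    exact h k m hk hm hkm

/-- The difference of two squared nodes is `4π²(k - m)(k + m + α)`, and `-α` has positive distance
from the closed set `ℤ`. -/
theorem separated_of_ne_intCast {α : ℂ} (hα : ∀ j : ℤ, (j : ℂ) ≠ α) (κ : ℤ → ℂ) :
    Separated α κ := by
  have hcl : IsClosed (range ((↑) : ℤ → ℂ)) := Complex.isClosedEmbedding_intCast.isClosed_range
  have hpos : 0 < Metric.infDist (-α) (range ((↑) : ℤ → ℂ)) := by
    rw [← hcl.notMem_iff_infDist_pos (range_nonempty _)]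
    rintro ⟨j, hj⟩
    exact hα (-j) (by push_cast; rw [hj, neg_neg])
  refine separated_of_forall_le hpos fun k m _ _ _ => ?_
  have := Metric.infDist_le_dist_of_mem (x := -α) (mem_range_self (f := ((↑) : ℤ → ℂ)) (k + m))
  rwa [dist_comm, dist_eq_norm, sub_neg_eq_add] at this

/-- Serves integer `α`, where squared nodes coincide in pairs. Two distinct indices `k, m ≥ 0` have
`k + m ≥ 1`, so the factor `k + m + α` has real part at least `1`. -/
theorem separated_of_eq_zero_of_neg {α : ℂ} (hα : 0 ≤ α.re) {κ : ℤ → ℂ}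
    (h : ∀ k : ℤ, k < 0 → κ k = 0) : Separated α κ := by
  refine separated_of_forall_le one_pos fun k m hk hm hkm => ?_
  have h1 : 0 ≤ k := by by_contra hc; exact hk (h k (not_le.1 hc))
  have h2 : 0 ≤ m := by by_contra hc; exact hm (h m (not_le.1 hc))
  have h3 : 1 ≤ k + m := by omega
  have h4 : (1 : ℝ) ≤ ((k + m : ℤ) : ℝ) := by exact_mod_cast h3
  refine le_trans ?_ (Complex.re_le_norm _)
  rw [Complex.add_re, Complex.intCast_re]
  linarith

theorem Separated.injOn {α : ℂ} {κ : ℤ → ℂ} (h : Separated α κ) (k m : ℤ) (hk : κ k ≠ 0)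
    (hm : κ m ≠ 0) (hkm : k ≠ m) : node α k ^ 2 ≠ node α m ^ 2 := by
  obtain ⟨c, hc, h⟩ := h
  intro heq
  have := h k m hk hm
  rw [heq, sub_self, norm_zero] at this
  have h1 : 0 < |(k - m : ℝ)| := abs_pos.2 (sub_ne_zero.2 (by exact_mod_cast hkm))
  nlinarith [mul_pos hc h1]

/-- The case `d = 0` holds because division by zero gives zero; it covers the diagonal term in the
residue sums. -/
theorem norm_div_le_of_mul_abs_le {c d : ℝ} (hc : 0 < c) {x y : ℂ} (h : c * |d| ≤ ‖y‖)
    (hd : d = 0 → y = 0) : ‖x / y‖ ≤ ‖x‖ ^ 2 + 1 / c ^ 2 * (1 / |d| ^ 2) := by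
  by_cases hd0 : d = 0
  · rw [hd hd0, div_zero, norm_zero]; positivity
  · refine (norm_div_le_sq_add _ _).trans (add_le_add_right ?_ _)
    rw [one_div_mul_one_div, ← mul_pow]
    have : 0 < c * |d| := mul_pos hc (abs_pos.2 hd0)
    exact one_div_le_one_div_of_le (by positivity) (pow_le_pow_left₀ this.le h 2)

theorem sum_one_div_sub_sq_le (n : ℤ) (s : Finset ℤ) :
    ∑ m ∈ s, 1 / |(n - m : ℝ)| ^ 2 ≤ ∑' k : ℤ, 1 / |(k : ℝ)| ^ 2 := by
  have hs := (Equiv.subLeft n).summable_iff.2 summable_one_div_intCast_sq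
  have ht := (Equiv.subLeft n).tsum_eq fun k : ℤ => 1 / |(k : ℝ)| ^ 2
  rw [← ht]
  refine le_trans (le_of_eq ?_) (hs.sum_le_tsum s fun _ _ => by positivity)
  refine Finset.sum_congr rfl fun m _ => ?_
  simp

/-- After the splitting `‖x/y‖ ≤ ‖x‖² + ‖y‖⁻²` the bound is uniform in `n`, since `∑ 1/(n - m)²` is
invariant under translation. -/
theorem Separated.exists_sum_le {α : ℂ} {κ : ℤ → ℂ} (h : Separated α κ)
    (hκ : Summable fun k => ‖κ k‖ ^ 2) : ∃ K : ℝ, ∀ n, κ n ≠ 0 → ∀ s : Finset ℤ,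
      ∑ m ∈ s, ‖κ m / (node α n ^ 2 - node α m ^ 2)‖ ≤ K := by
  obtain ⟨c, hc, h⟩ := h
  refine ⟨∑' k, ‖κ k‖ ^ 2 + 1 / c ^ 2 * ∑' k : ℤ, 1 / |(k : ℝ)| ^ 2, fun n hn s => ?_⟩
  have h1 : ∀ m ∈ s, ‖κ m / (node α n ^ 2 - node α m ^ 2)‖ ≤
      ‖κ m‖ ^ 2 + 1 / c ^ 2 * (1 / |(n - m : ℝ)| ^ 2) := fun m _ => by
    by_cases hm : κ m = 0
    · rw [hm, zero_div, norm_zero]; positivity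
    · refine norm_div_le_of_mul_abs_le hc (h n m hn hm) fun h0 => ?_
      have : n = m := by exact_mod_cast sub_eq_zero.1 h0
      rw [this, sub_self]
  refine (Finset.sum_le_sum h1).trans ?_
  rw [Finset.sum_add_distrib, ← Finset.mul_sum]
  exact add_le_add (hκ.sum_le_tsum _ fun _ _ => by positivity)
    (mul_le_mul_of_nonneg_left (sum_one_div_sub_sq_le n s) (by positivity))

/-! ### The unperturbed characteristic function -/

theorem one_add_sq_sub_cos {γ α : ℂ} (hγ : γ ≠ 0)
    (hα : Complex.cos (Real.pi * α) = (1 + γ ^ 2) / (2 * γ)) (ρ : ℂ) :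
    1 + γ ^ 2 - 2 * γ * Complex.cos ρ = 2 * γ * (Complex.cos (Real.pi * α) - Complex.cos ρ) := by
  rw [hα]; field_simp

theorem cos_sub_cos_eq_sin_mul_sin (β ρ : ℂ) : Complex.cos β - Complex.cos ρ =
    2 * (Complex.sin ((ρ - β) / 2) * Complex.sin ((ρ + β) / 2)) := by
  rw [Complex.cos_sub_cos, show (β - ρ) / 2 = -((ρ - β) / 2) by ring, Complex.sin_neg, add_comm β]
  ring

theorem analyticOrderAt_sin_half (β ρ : ℂ) :
    analyticOrderAt (fun z => Complex.sin ((z - β) / 2)) ρ =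
      {k : ℤ | 2 * Real.pi * k + β = ρ}.encard := by
  have han : AnalyticAt ℂ (fun z => Complex.sin ((z - β) / 2)) ρ := by
    apply Differentiable.analyticAt; fun_prop
  by_cases h : Complex.sin ((ρ - β) / 2) = 0
  · obtain ⟨k, hk⟩ := Complex.sin_eq_zero_iff.1 h
    have hset : {k : ℤ | (2 * Real.pi * k + β : ℂ) = ρ} = {k} := by
      ext j
      simp only [mem_ofPred_eq, mem_singleton_iff]
      have hpi : (Real.pi : ℂ) ≠ 0 := by exact_mod_cast Real.pi_ne_zero
      constructor
      · intro hj
        have : (j : ℂ) * Real.pi = k * Real.pi := by rw [← hk, ← hj]; ring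
        exact_mod_cast mul_right_cancel₀ hpi this
      · rintro rfl
        linear_combination -2 * hk
    rw [hset, encard_singleton]
    refine han.analyticOrderAt_eq_one_of_zero_deriv_ne_zero h ?_
    have hd : HasDerivAt (fun z => Complex.sin ((z - β) / 2)) (Complex.cos ((ρ - β) / 2) * (1 / 2)) ρ :=
      (((hasDerivAt_id ρ).sub_const β).div_const 2).csin
    rw [hd.deriv]
    have := Complex.sin_sq_add_cos_sq ((ρ - β) / 2)
    rw [h] at this
    intro h0
    have hc : Complex.cos ((ρ - β) / 2) = 0 := by simpa using h0
    rw [hc] at this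
    norm_num at this
  · rw [han.analyticOrderAt_eq_zero.2 h, eq_comm, encard_eq_zero, eq_empty_iff_forall_notMem]
    intro k hk
    apply h
    rw [Complex.sin_eq_zero_iff]
    exact ⟨k, by rw [← (hk : _ = ρ)]; ring⟩

/-- Pulled back by `ρ ↦ ρ²`, the function is `4γ sin((ρ - πα)/2) sin((ρ + πα)/2)`, and each factor
has simple zeros. The sets `A` and `B` count the nodes at `ρ` and at `-ρ`. -/
theorem analyticOrderAt_unperturbed {γ α : ℂ} (hγ : γ ≠ 0)
    (hα : Complex.cos (Real.pi * α) = (1 + γ ^ 2) / (2 * γ)) {Δ₀ : ℂ → ℂ}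
    (hΔ₀ : Differentiable ℂ Δ₀) (h : ∀ ρ, Δ₀ (ρ ^ 2) = 1 + γ ^ 2 - 2 * γ * Complex.cos ρ) (μ : ℂ) :
    analyticOrderAt Δ₀ μ = {k | node α k ^ 2 = μ}.encard := by
  obtain ⟨ρ, rfl⟩ := exists_sq_eq μ
  set β : ℂ := Real.pi * α with hβ
  set A := {k : ℤ | node α k = ρ} with hA
  set B := {k : ℤ | node α k = -ρ} with hB
  have hAB : {k | node α k ^ 2 = ρ ^ 2} = A ∪ B := by
    ext k; simp only [mem_ofPred_eq, mem_union, hA, hB, sq_eq_sq_iff_eq_or_eq_neg]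
  have s1 : {k : ℤ | (2 * Real.pi * k + β : ℂ) = ρ} = A := by
    ext k
    simp only [mem_ofPred_eq, hA, node, hβ]
    rw [show (Real.pi * (2 * k + α) : ℂ) = 2 * Real.pi * k + Real.pi * α by ring]
  have s2 : {k : ℤ | (2 * Real.pi * k + -β : ℂ) = ρ}.encard = B.encard := by
    have : {k : ℤ | (2 * Real.pi * k + -β : ℂ) = ρ} = Neg.neg '' B := by
      ext k
      simp only [mem_ofPred_eq, hB, node, hβ, image_neg_eq_neg, Set.mem_neg]
      rw [← neg_inj]
      push_cast
      rw [show (Real.pi * (2 * -k + α) : ℂ) = -(2 * Real.pi * k + -(Real.pi * α)) by ring]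
    rw [this, neg_injective.encard_image]
  have hord : analyticOrderAt (Δ₀ ∘ fun z => z ^ 2) ρ = A.encard + B.encard := by
    have hfun : (Δ₀ ∘ fun z => z ^ 2) = (fun _ => 4 * γ) *
        ((fun z => Complex.sin ((z - β) / 2)) * fun z => Complex.sin ((z - -β) / 2)) := by
      funext z
      simp only [Function.comp_apply, Pi.mul_apply, h, sub_neg_eq_add]
      rw [one_add_sq_sub_cos hγ hα, cos_sub_cos_eq_sin_mul_sin]; ring
    have a1 : ∀ b : ℂ, AnalyticAt ℂ (fun z => Complex.sin ((z - b) / 2)) ρ := fun b => by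
      apply Differentiable.analyticAt; fun_prop
    rw [hfun, analyticOrderAt_mul (by fun_prop) ((a1 _).mul (a1 _)),
      analyticOrderAt_mul (a1 _) (a1 _), analyticOrderAt_sin_half, analyticOrderAt_sin_half, s1, s2,
      (analyticAt_const.analyticOrderAt_eq_zero).2 (by simpa using hγ), zero_add]
  -- At `ρ = 0` squaring doubles the order while `A = B`; elsewhere squaring preserves the order and
  -- `A`, `B` are disjoint.
  by_cases hρ : ρ = 0
  · have hBA : B = A := by rw [hA, hB, hρ, neg_zero]
    have h2 : analyticOrderAt (fun z : ℂ => z ^ 2 - ρ ^ 2) ρ = 2 := by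
      subst hρ
      have : (fun z : ℂ => z ^ 2 - 0 ^ 2) = (id : ℂ → ℂ) ^ 2 := by funext z; simp
      rw [this, analyticOrderAt_pow analyticAt_id, analyticOrderAt_id]; simp
    rw [AnalyticAt.analyticOrderAt_comp (hΔ₀.analyticAt _) (by fun_prop), h2, hBA, ← mul_two] at hord
    rw [hAB, hBA, union_self]
    exact (ENat.mul_left_strictMono two_ne_zero (by simp)).injective hord
  · have hd : deriv (fun z : ℂ => z ^ 2) ρ ≠ 0 := by simpa using hρ
    rw [analyticOrderAt_comp_of_deriv_ne_zero (by fun_prop) hd] at hord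
    rw [hAB, encard_union_eq, hord]
    rw [Set.disjoint_left]
    intro k hk hk'
    exact hρ (self_eq_neg.1 ((hk : node α k = ρ).symm.trans hk'))

/-! ### Realizing prescribed zeros -/

/-- With `P` the product of shift factors, `Δ₀(P - 1)` expands into fractions with square-summable
residues, so it is the sine transform of a cosine series in `L₂`. Hence the given `Δ` is `Δ₀P`,
whose zeros are the shifted nodes. -/
theorem exists_sinTransform_of_zeros {γ α : ℂ} (hγ : γ ≠ 0)
    (hα : Complex.cos (Real.pi * α) = (1 + γ ^ 2) / (2 * γ)) {κ : ℤ → ℂ}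
    (hκ : Summable fun k => ‖κ k‖ ^ 2) (hsep : Separated α κ) :
    ∃ F : L2, ∀ Δ : ℂ → ℂ, Differentiable ℂ Δ →
      (∀ ρ, Δ (ρ ^ 2) = 1 + γ ^ 2 - 2 * γ * Complex.cos ρ -
        sinTransform (fun u => -2 * γ * cosSeries α F u) ρ) →
      ∀ μ, analyticOrderAt Δ μ = {k | node α k ^ 2 + κ k = μ}.encard := by
  obtain ⟨K, hK⟩ := hsep.exists_sum_le hκ
  have hs := summable_norm_div_sub_node_sq (α := α) hκ
  obtain ⟨b, hb, hbsum⟩ := exists_tprod_shiftFactor_eq (l := fun k => node α k ^ 2) hsep.injOn hs hK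
  have hb2 : Summable fun k => ‖b k‖ ^ 2 := by
    refine Summable.of_nonneg_of_le (fun _ => by positivity) (fun k => ?_)
      (hκ.mul_left (Real.exp K ^ 2))
    rw [← mul_pow]
    exact pow_le_pow_left₀ (norm_nonneg _) (hb k) 2
  obtain ⟨F, hF⟩ := exists_hasSum_expL2 hb2
  refine ⟨F, fun Δ hΔ hΔeq μ => ?_⟩
  obtain ⟨Δ₀, hΔ₀, hΔ₀eq⟩ := exists_entire_charFunction γ (W := fun _ => 0) (by simp)
  have hΔ₀eq' : ∀ ρ, Δ₀ (ρ ^ 2) = 1 + γ ^ 2 - 2 * γ * Complex.cos ρ := fun ρ => by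
    rw [hΔ₀eq, sinTransform]; simp
  refine analyticOrderAt_of_eq_mul_tprod hΔ hΔ₀ hs (tendsto_norm_node_sq α) (fun z hz => ?_) μ
    (analyticOrderAt_unperturbed hγ hα hΔ₀ hΔ₀eq' μ)
  obtain ⟨ρ, rfl⟩ := exists_sq_eq z
  have h1 := hasSum_sinTransform_cosSeries α hF hz
  have h2 := (hbsum (ρ ^ 2) hz).mul_left (Complex.cos (Real.pi * α) - Complex.cos ρ)
  have h3 : sinTransform (cosSeries α F) ρ = (Complex.cos (Real.pi * α) - Complex.cos ρ) *
      (∏' n, shiftFactor (fun k => node α k ^ 2) κ (ρ ^ 2) n - 1) := by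
    have e : (fun k => b k * ((Complex.cos (Real.pi * α) - Complex.cos ρ) /
        (ρ ^ 2 - node α k ^ 2))) = fun k => (Complex.cos (Real.pi * α) - Complex.cos ρ) *
        (b k / (ρ ^ 2 - node α k ^ 2)) := by funext k; ring
    rw [e] at h1
    exact h1.unique h2
  have h4 : sinTransform (fun u => -2 * γ * cosSeries α F u) ρ =
      -2 * γ * sinTransform (cosSeries α F) ρ := by
    rw [sinTransform, sinTransform, ← intervalIntegral.integral_const_mul]
    congr 1 with u; ring
  rw [hΔeq, hΔ₀eq', h4, h3, one_add_sq_sub_cos hγ hα]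
  ring

theorem charDet_eq_sinTransform {a : ℝ} (ha : a ∈ Icc (0 : ℝ) 1) {γ : ℂ} {q : L2} {X W : ℝ → ℂ}
    (hX : unfoldAt a γ q =ᵐ[unitMeasure] X)
    (hW : ∀ᵐ u ∂unitMeasure, X u + γ * X (1 - u) = W u) (ρ : ℂ) :
    charDet q a γ ρ = 1 + γ ^ 2 - 2 * γ * Complex.cos ρ - sinTransform W ρ := by
  have hXm : MemLp X 2 unitMeasure := (memLp_unfoldAt ha γ (Lp.memLp q)).ae_eq hX
  rw [charDet_eq ha γ ρ (Lp.memLp q),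
    unfoldAt_ae_congr (g := fun u => sinOver ρ u + γ * sinOver ρ (1 - u)) hX, integral_fold hXm,
    sinTransform, ← integral_unitMeasure, ← integral_unitMeasure]
  congr 1
  refine integral_congr_ae ?_
  filter_upwards [hW] with u hu; rw [hu]

theorem isSpectrum_of_analyticOrderAt {q : L2} {a : ℝ} (ha : a ∈ Icc (0 : ℝ) 1) {γ : ℂ}
    {lam : ℕ → ℂ} {Δ : ℂ → ℂ} (hΔ : Differentiable ℂ Δ)
    (heq : ∀ ρ, Δ (ρ ^ 2) = charDet q a γ ρ)
    (hord : ∀ μ, analyticOrderAt Δ μ = {n | lam n = μ}.encard) : IsSpectrum q a γ lam := by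
  refine ⟨fun μ => ?_, Δ, isCharFunction_of_apply_sq ha heq, fun n => (hord _).symm⟩
  obtain ⟨ρ, rfl⟩ := exists_sq_eq μ
  rw [isEigenvalue_sq_iff ha, ← heq, ← (hΔ.analyticAt _).analyticOrderAt_ne_zero, hord,
    encard_ne_zero]
  rfl

/-- The definition of the spectrum fixes the order only at the values of `lam`; at any other point
both sides are zero, since the point is not an eigenvalue. -/
theorem IsSpectrum.analyticOrderAt_eq {q : L2} {a : ℝ} (ha : a ∈ Icc (0 : ℝ) 1) {γ : ℂ}
    {lam : ℕ → ℂ} (h : IsSpectrum q a γ lam) {Δ : ℂ → ℂ} (hΔ : Differentiable ℂ Δ)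
    (heq : ∀ ρ, Δ (ρ ^ 2) = charDet q a γ ρ) (μ : ℂ) :
    analyticOrderAt Δ μ = {n | lam n = μ}.encard := by
  obtain ⟨h1, Δ', hΔ', h2⟩ := h
  have : Δ' = Δ := by
    funext z
    obtain ⟨ρ, rfl⟩ := exists_sq_eq z
    rw [hΔ'.apply_sq ha, heq]
  subst this
  by_cases hμ : ∃ n, lam n = μ
  · obtain ⟨n, rfl⟩ := hμ
    exact (h2 n).symm
  · have hne : ¬ IsEigenvalue q a γ μ := fun h => hμ ((h1 μ).2 h)
    obtain ⟨ρ, rfl⟩ := exists_sq_eq μ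
    rw [isEigenvalue_sq_iff ha, ← heq] at hne
    rw [(hΔ.analyticAt _).analyticOrderAt_eq_zero.2 hne, eq_comm, encard_eq_zero,
      eq_empty_iff_forall_notMem]
    exact fun n hn => hμ ⟨n, hn⟩

/-! ### Sequences indexed by `ℤ` -/

/-- The bijection sends `k ≥ 0` to `2k` and `-k < 0` to `2k - 1`. As `(2k - α)² = (-2k + α)²`, both
families become one family of nodes over `ℤ`. -/
theorem HasAsymptotics.apply_intEquivNat {α : ℂ} {lam κ : ℕ → ℂ} (h : HasAsymptotics α lam κ)
    (k : ℤ) : lam (Equiv.intEquivNat k) = node α k ^ 2 + κ (Equiv.intEquivNat k) := by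
  match k with
  | Int.ofNat n =>
    change lam (2 * n) = _ + κ (2 * n)
    rw [h.1 n, node, Int.ofNat_eq_natCast, Int.cast_natCast]; ring
  | Int.negSucc n =>
    have := h.2.1 (n + 1) (by omega)
    rw [show 2 * (n + 1) - 1 = 2 * n + 1 by omega] at this
    change lam (2 * n + 1) = _ + κ (2 * n + 1)
    rw [this, node, Int.cast_negSucc]; push_cast; ring

theorem HasAsymptotics.encard_eq {α : ℂ} {lam κ : ℕ → ℂ} (h : HasAsymptotics α lam κ) (μ : ℂ) :
    {n | lam n = μ}.encard = {k | node α k ^ 2 + κ (Equiv.intEquivNat k) = μ}.encard := by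
  rw [← Equiv.intEquivNat.injective.encard_image]
  congr 1
  ext n
  simp only [mem_ofPred_eq, mem_image]
  constructor
  · intro hn
    exact ⟨Equiv.intEquivNat.symm n, by
      rw [← h.apply_intEquivNat, Equiv.apply_symm_apply]; exact hn, Equiv.apply_symm_apply _ _⟩
  · rintro ⟨k, hk, rfl⟩
    rw [h.apply_intEquivNat, hk]

theorem HasAsymptotics.summable {α : ℂ} {lam κ : ℕ → ℂ} (h : HasAsymptotics α lam κ) :
    Summable fun k => ‖κ (Equiv.intEquivNat k)‖ ^ 2 := by
  have h1 := (memℓp_gen_iff (by norm_num)).1 h.2.2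
  have h2 : Summable fun n => ‖κ n‖ ^ 2 := by
    refine h1.congr fun n => ?_
    simp
  exact Equiv.intEquivNat.summable_iff.2 h2

/-! ### Solving the folding equation: existence, and non-uniqueness for `γ = ±1` -/

theorem exists_isSpectrum_of_fold {γ α : ℂ} {a : ℝ} (hγ : γ ≠ 0) (ha : a ∈ Icc (0 : ℝ) 1)
    (hα : Complex.cos (Real.pi * α) = (1 + γ ^ 2) / (2 * γ)) {lam κ : ℕ → ℂ}
    (h : HasAsymptotics α lam κ) (hsep : Separated α fun k => κ (Equiv.intEquivNat k)) :
    ∃ F : L2, ∀ X : ℝ → ℂ, MemLp X 2 unitMeasure →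
      (∀ u, X u + γ * X (1 - u) = -2 * γ * cosSeries α F u) →
      ∃ q : L2, unfoldAt a γ q =ᵐ[unitMeasure] X ∧ IsSpectrum q a γ lam := by
  obtain ⟨F, hF⟩ := exists_sinTransform_of_zeros hγ hα h.summable hsep
  refine ⟨F, fun X hX hfold => ?_⟩
  obtain ⟨q, hq⟩ := exists_unfoldAt_eq ha hγ hX
  refine ⟨q, hq, ?_⟩
  have hW : IntervalIntegrable (fun u => -2 * γ * cosSeries α F u) volume 0 1 :=
    intervalIntegrable_of_memLp_two ((memLp_cosSeries α (Lp.memLp F)).const_mul (-2 * γ))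
  obtain ⟨Δ, hΔ, heq⟩ := exists_entire_charFunction γ hW
  refine isSpectrum_of_analyticOrderAt ha hΔ (fun ρ => ?_) fun μ => ?_
  · rw [heq, charDet_eq_sinTransform ha hq (Eventually.of_forall hfold)]
  · rw [hF Δ hΔ heq, h.encard_eq]

/-- For integer `α` the cosine is `±1`, so `1 + γ² = ±2γ`, which means `γ = ±1`. -/
theorem IsShift.ne_intCast {γ α : ℂ} (hγ : γ ≠ 0) (h1 : γ ≠ 1) (h2 : γ ≠ -1)
    (h : IsShift γ α) (j : ℤ) : (j : ℂ) ≠ α := by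
  rintro rfl
  have hc := h.1
  rw [eq_div_iff (by simpa using hγ)] at hc
  have hs : Complex.sin (Real.pi * j) = 0 := by
    rw [mul_comm]; exact Complex.sin_int_mul_pi j
  have h3 := Complex.sin_sq_add_cos_sq (Real.pi * j)
  rw [hs] at h3
  have h4 : (Complex.cos (Real.pi * j) - 1) * (Complex.cos (Real.pi * j) + 1) = 0 := by
    linear_combination h3
  rcases mul_eq_zero.1 h4 with h5 | h5
  · have : (γ - 1) ^ 2 = 0 := by linear_combination 2 * γ * h5 - hc
    exact h1 (sub_eq_zero.1 (pow_eq_zero_iff two_ne_zero |>.1 this))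
  · have : (γ + 1) ^ 2 = 0 := by linear_combination 2 * γ * h5 - hc
    exact h2 (eq_neg_of_add_eq_zero_left (pow_eq_zero_iff two_ne_zero |>.1 this))

theorem exists_isSpectrum {γ α : ℂ} {a : ℝ} (hγ : γ ≠ 0) (h1 : γ ≠ 1) (h2 : γ ≠ -1)
    (ha : a ∈ Icc (0 : ℝ) 1) (hα : IsShift γ α) {lam κ : ℕ → ℂ} (h : HasAsymptotics α lam κ) :
    ∃ q : L2, IsSpectrum q a γ lam := by
  obtain ⟨F, hF⟩ := exists_isSpectrum_of_fold hγ ha hα.1 h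
    (separated_of_ne_intCast (hα.ne_intCast hγ h1 h2) _)
  set W : ℝ → ℂ := fun u => -2 * γ * cosSeries α F u with hW
  have hWm : MemLp W 2 unitMeasure := (memLp_cosSeries α (Lp.memLp F)).const_mul _
  have hne : 1 - γ ^ 2 ≠ 0 := fun h0 => by
    have : (γ - 1) * (γ + 1) = 0 := by linear_combination -h0
    rcases mul_eq_zero.1 this with h | h
    · exact h1 (sub_eq_zero.1 h)
    · exact h2 (eq_neg_of_add_eq_zero_left h)
  -- With `RX(u) = X(1 - u)` and `R² = 1`, the inverse of `1 + γR` is `(1 - γR)/(1 - γ²)`.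
  obtain ⟨q, -, hq⟩ := hF (fun u => (1 - γ ^ 2)⁻¹ * (W u - γ * W (1 - u)))
    ((hWm.sub ((memLp_comp_one_sub hWm).const_mul γ)).const_mul _) fun u => by
      simp only [sub_sub_cancel]
      change _ = W u
      field_simp
      ring
  exact ⟨q, hq⟩

theorem IsShift.exp_eq {γ α : ℂ} (hγ : γ = 1 ∨ γ = -1) (h : IsShift γ α) :
    Complex.exp (Complex.I * Real.pi * α) = γ := by
  have hc : Complex.cos (Real.pi * α) = γ := by
    rw [h.1]; rcases hγ with rfl | rfl <;> norm_num
  have hs : Complex.sin (Real.pi * α) = 0 := by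
    have := Complex.sin_sq_add_cos_sq (Real.pi * α)
    rw [hc] at this
    have h2 : γ ^ 2 = 1 := by rcases hγ with rfl | rfl <;> norm_num
    rw [h2] at this
    exact pow_eq_zero_iff two_ne_zero |>.1 (by linear_combination this)
  rw [show Complex.I * Real.pi * α = (Real.pi * α) * Complex.I by ring, Complex.exp_mul_I, hc, hs]
  ring

/-- The right-hand side satisfies `W(1 - u) = γW(u)`, so `W/2` solves the folding equation; any `c`
with `c(u) + γc(1 - u) = 0` may be added. -/
theorem exists_ne_isSpectrum {γ α : ℂ} {a : ℝ} (hγ : γ = 1 ∨ γ = -1) (ha : a ∈ Icc (0 : ℝ) 1)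
    (hα : IsShift γ α) {lam κ : ℕ → ℂ} (h : HasAsymptotics α lam κ)
    (hκ : ∀ k : ℕ, 1 ≤ k → κ (2 * k - 1) = 0) :
    ∃ q₁ q₂ : L2, q₁ ≠ q₂ ∧ IsSpectrum q₁ a γ lam ∧ IsSpectrum q₂ a γ lam := by
  have hγ0 : γ ≠ 0 := by rcases hγ with rfl | rfl <;> norm_num
  have hγ2 : γ * γ = 1 := by rcases hγ with rfl | rfl <;> norm_num
  have hre : 0 ≤ α.re := by rcases hα.2 with h | h <;> linarith [h.1]
  obtain ⟨F, hF⟩ := exists_isSpectrum_of_fold hγ0 ha hα.1 h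
    (separated_of_eq_zero_of_neg hre fun k hk => by
      match k with
      | Int.ofNat n => exact absurd hk (by simp)
      | Int.negSucc n =>
        have := hκ (n + 1) (by omega)
        rwa [show 2 * (n + 1) - 1 = 2 * n + 1 by omega] at this)
  set W : ℝ → ℂ := fun u => -2 * γ * cosSeries α F u with hW
  have hWm : MemLp W 2 unitMeasure := (memLp_cosSeries α (Lp.memLp F)).const_mul _
  have hWs : ∀ u, W (1 - u) = γ * W u := fun u => by
    simp only [hW, cosSeries_one_sub hγ (hα.exp_eq hγ)]; ring
  have hX : ∀ c : ℂ → ℝ → ℂ, Continuous (c γ) → (∀ u, c γ u + γ * c γ (1 - u) = 0) →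
      ∃ q : L2, unfoldAt a γ q =ᵐ[unitMeasure] (fun u => 2⁻¹ * W u + c γ u) ∧
        IsSpectrum q a γ lam := fun c hc hc0 => by
    refine hF _ ((hWm.const_mul _).add (memLp_of_continuousOn hc.continuousOn)) fun u => ?_
    change _ = W u
    rw [hWs]
    linear_combination hc0 u + 2⁻¹ * W u * hγ2
  obtain ⟨q₁, hq₁, hs₁⟩ := hX (fun _ _ => 0) continuous_const (by simp)
  -- a nonzero function in the kernel of the folding map
  obtain ⟨q₂, hq₂, hs₂⟩ := hX (fun γ u => (1 - γ) + (1 + γ) * (u - 1 / 2)) (by fun_prop)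
    (fun u => by push_cast; linear_combination (-u - 1 / 2) * hγ2)
  refine ⟨q₁, q₂, fun heq => ?_, hs₁, hs₂⟩
  subst heq
  -- Equality of the potentials forces the added function to vanish almost everywhere; it is `2u -
  -- 1` for `γ = 1` and the constant `2` for `γ = -1`.
  have hz : ∀ᵐ u ∂unitMeasure, u = 1 / 2 := by
    filter_upwards [hq₁, hq₂] with u h1 h2
    rw [h1] at h2
    have h3 : (1 - γ) + (1 + γ) * ((u : ℂ) - 1 / 2) = 0 := by linear_combination -h2
    rcases hγ with rfl | rfl
    · have : (u : ℂ) = ((1 / 2 : ℝ) : ℂ) := by push_cast; linear_combination h3 / 2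
      exact_mod_cast this
    · norm_num at h3
  have hn : ∀ᵐ u ∂unitMeasure, u ≠ 1 / 2 :=
    ae_restrict_of_ae (by simp [ae_iff, measure_singleton])
  have hf : ∀ᵐ u ∂unitMeasure, False := by filter_upwards [hz, hn] with u h1 h2 using h2 h1
  have := ae_iff.1 hf
  simp at this

/-! ### Quotients of entire functions with the same zeros -/

/-- Near each point the common power of `z - z₀` cancels and leaves an analytic quotient. The zeros
of `g` are isolated, so the local quotients agree where they overlap and glue along the diagonal. -/
theorem exists_differentiable_mul_eq {f g : ℂ → ℂ} (hf : Differentiable ℂ f)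
    (hg : Differentiable ℂ g) (hord : ∀ z, analyticOrderAt f z = analyticOrderAt g z)
    (hfin : ∀ z, analyticOrderAt g z ≠ ⊤) :
    ∃ h : ℂ → ℂ, Differentiable ℂ h ∧ ∀ z, f z = h z * g z := by
  have hloc : ∀ z, ∃ k : ℂ → ℂ, AnalyticAt ℂ k z ∧ ∀ᶠ w in 𝓝 z, f w = k w * g w ∧
      (w ≠ z → g w ≠ 0) := fun z => by
    obtain ⟨n, hn⟩ := ENat.ne_top_iff_exists.1 (hfin z)
    obtain ⟨F, hFa, hF, hfF⟩ :=
      ((hf.analyticAt z).analyticOrderAt_eq_natCast).1 ((hord z).trans hn.symm)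
    obtain ⟨G, hGa, hG, hgG⟩ := ((hg.analyticAt z).analyticOrderAt_eq_natCast).1 hn.symm
    refine ⟨fun w => F w / G w, hFa.div hGa hG, ?_⟩
    filter_upwards [hfF, hgG, hGa.continuousAt.eventually_ne hG] with w h1 h2 h3
    rw [h1, h2, smul_eq_mul, smul_eq_mul]
    refine ⟨by field_simp, fun hw => mul_ne_zero (pow_ne_zero _ (sub_ne_zero.2 hw)) h3⟩
  choose k hka hk using hloc
  have hself : ∀ z, ∀ᶠ w in 𝓝 z, k w w = k z w := fun z => by
    filter_upwards [eventually_eventually_nhds.2 (hk z)] with w hw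
    have h1 : k w =ᶠ[𝓝[≠] w] k z := by
      have hgz : ∀ᶠ v in 𝓝[≠] w, g v ≠ 0 := by
        filter_upwards [(hk w).filter_mono nhdsWithin_le_nhds, self_mem_nhdsWithin] with v hv hne
          using hv.2 hne
      filter_upwards [(hk w).filter_mono nhdsWithin_le_nhds, hw.filter_mono nhdsWithin_le_nhds,
        hgz] with v h1 h2 h3
      exact mul_right_cancel₀ h3 (h1.1.symm.trans h2.1)
    by_cases hwz : w = z
    · rw [hwz]
    · have hgw : g w ≠ 0 := hw.self_of_nhds.2 hwz
      exact mul_right_cancel₀ hgw ((hk w).self_of_nhds.1.symm.trans hw.self_of_nhds.1)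
  refine ⟨fun z => k z z, fun z => ?_, fun z => (hk z).self_of_nhds.1⟩
  exact ((hka z).differentiableAt).congr_of_eventuallyEq (hself z)

/-! ### Lower bounds for the unperturbed characteristic function -/

theorem cos_re (z : ℂ) : (Complex.cos z).re = Real.cos z.re * Real.cosh z.im := by
  rw [Complex.cos_eq]
  simp [← Complex.ofReal_cos, ← Complex.ofReal_cosh, ← Complex.ofReal_sin, ← Complex.ofReal_sinh]

theorem le_norm_cos (z : ℂ) : (Real.exp |z.im| - 1) / 2 ≤ ‖Complex.cos z‖ := by
  have h1 : ‖Complex.exp (z * Complex.I)‖ = Real.exp (-z.im) := by rw [Complex.norm_exp]; simp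
  have h2 : ‖Complex.exp (-z * Complex.I)‖ = Real.exp z.im := by rw [Complex.norm_exp]; simp
  rw [Complex.cos, norm_div, Complex.norm_ofNat]
  gcongr
  rcases le_total 0 z.im with h | h
  · have h3 := norm_sub_norm_le (Complex.exp (-z * Complex.I)) (-Complex.exp (z * Complex.I))
    rw [sub_neg_eq_add, add_comm, norm_neg, h1, h2] at h3
    rw [abs_of_nonneg h]
    have : Real.exp (-z.im) ≤ 1 := Real.exp_le_one_iff.2 (by linarith)
    linarith
  · have h3 := norm_sub_norm_le (Complex.exp (z * Complex.I)) (-Complex.exp (-z * Complex.I))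
    rw [sub_neg_eq_add, norm_neg, h1, h2] at h3
    rw [abs_of_nonpos h]
    have : Real.exp z.im ≤ 1 := Real.exp_le_one_iff.2 h
    linarith

/-- Far from the real axis the cosine dominates `B`. In the remaining strip, bounds on equally
spaced vertical lines suffice, since these serve as sides of large rectangles. -/
theorem exists_le_norm_sub_cos (B : ℂ) : ∃ x₀ c Y : ℝ, 0 < c ∧ ∀ ρ : ℂ,
    (|ρ.im| ≥ Y ∨ ∃ k : ℤ, ρ.re = x₀ + k * (2 * Real.pi)) →
      c * Real.exp |ρ.im| ≤ ‖B - Complex.cos ρ‖ := by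
  -- On lines through `2πk` the real part of the cosine is `cosh (Im ρ) ≥ 1`; on lines through `π/2
  -- + 2πk` it is zero. The first choice works when `Re B = 0`, the second otherwise.
  obtain ⟨x₀, δ, hδ, hline⟩ : ∃ x₀ δ : ℝ, 0 < δ ∧ ∀ ρ : ℂ,
      (∃ k : ℤ, ρ.re = x₀ + k * (2 * Real.pi)) → δ ≤ ‖B - Complex.cos ρ‖ := by
    by_cases hB : B.re = 0
    · refine ⟨0, 1, one_pos, fun ρ ⟨k, hk⟩ => ?_⟩
      have h1 : (B - Complex.cos ρ).re = -Real.cosh ρ.im := by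
        rw [Complex.sub_re, cos_re, hB, hk, Real.cos_add_int_mul_two_pi, Real.cos_zero]; ring
      have h2 := Complex.abs_re_le_norm (B - Complex.cos ρ)
      rw [h1, abs_neg, abs_of_pos (Real.cosh_pos _)] at h2
      exact (Real.one_le_cosh _).trans h2
    · refine ⟨Real.pi / 2, |B.re|, abs_pos.2 hB, fun ρ ⟨k, hk⟩ => ?_⟩
      have h1 : (B - Complex.cos ρ).re = B.re := by
        rw [Complex.sub_re, cos_re, hk, Real.cos_add_int_mul_two_pi, Real.cos_pi_div_two]; ring
      have h2 := Complex.abs_re_le_norm (B - Complex.cos ρ)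
      rwa [h1] at h2
  set Y : ℝ := 4 * (‖B‖ + 1) with hY
  refine ⟨x₀, min (1 / 4) (δ * Real.exp (-Y)), Y, lt_min (by norm_num) (by positivity),
    fun ρ hρ => ?_⟩
  by_cases hbig : Y ≤ |ρ.im|
  · have h1 := norm_sub_norm_le (Complex.cos ρ) B
    rw [norm_sub_rev] at h1
    have h2 := le_norm_cos ρ
    have h3 : Y + 1 ≤ Real.exp |ρ.im| := (Real.add_one_le_exp Y).trans (Real.exp_le_exp.2 hbig)
    have h4 : min (1 / 4) (δ * Real.exp (-Y)) * Real.exp |ρ.im| ≤ 1 / 4 * Real.exp |ρ.im| := by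
      gcongr; exact min_le_left _ _
    linarith [norm_nonneg B]
  · rcases hρ with h | h
    · exact absurd h hbig
    · have h5 : Real.exp |ρ.im| ≤ Real.exp Y := Real.exp_le_exp.2 (not_le.1 hbig).le
      calc min (1 / 4) (δ * Real.exp (-Y)) * Real.exp |ρ.im|
          ≤ δ * Real.exp (-Y) * Real.exp Y := by
            gcongr; exact min_le_right _ _
        _ = δ := by rw [mul_assoc, ← Real.exp_add]; simp
        _ ≤ _ := hline ρ h

/-- Maximum principle on the rectangle with vertical sides `x₀ ± 2πn` and horizontal sides `± n`:
for large `n` it contains `w` and its boundary lies where the bound is assumed. -/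
theorem norm_le_of_rectangles {f : ℂ → ℂ} (hf : Differentiable ℂ f) {x₀ Y R M : ℝ}
    (h : ∀ ρ : ℂ, R ≤ ‖ρ‖ → (|ρ.im| ≥ Y ∨ ∃ k : ℤ, ρ.re = x₀ + k * (2 * Real.pi)) → ‖f ρ‖ ≤ M)
    (w : ℂ) : ‖f w‖ ≤ M := by
  obtain ⟨n, hn⟩ := exists_nat_ge (|x₀| + |Y| + |R| + ‖w‖ + 1)
  have hpi := Real.pi_gt_three
  have hx := abs_nonneg x₀
  have hYn := abs_nonneg Y
  have hRn := abs_nonneg R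
  have hw := norm_nonneg w
  have hx1 := neg_abs_le x₀
  have hx2 := le_abs_self x₀
  have hR' := le_abs_self R
  have hY' := le_abs_self Y
  have hn0 : (0 : ℝ) < n := by linarith
  have hpn : 2 * (n : ℝ) ≤ n * (2 * Real.pi) := by nlinarith
  set p := n * (2 * Real.pi) with hp
  have hre := Complex.abs_re_le_norm w
  have him := Complex.abs_im_le_norm w
  rw [abs_le] at hre him
  set U : Set ℂ := Ioo (x₀ - p) (x₀ + p) ×ℂ Ioo (-n : ℝ) n with hU
  have hwU : w ∈ closure U := by
    apply subset_closure
    rw [hU, Complex.mem_reProdIm]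
    exact ⟨⟨by linarith, by linarith⟩, by linarith, by linarith⟩
  refine Complex.norm_le_of_forall_mem_frontier_norm_le
    ((Metric.isBounded_Ioo _ _).reProdIm (Metric.isBounded_Ioo _ _)) hf.diffContOnCl
    (fun z hz => ?_) hwU
  rw [Complex.frontier_reProdIm, frontier_Ioo (by linarith), frontier_Ioo (by linarith)] at hz
  rcases hz with hz | hz
  · have him : |z.im| = n := by
      rcases hz.2 with h | h
      · rw [show z.im = -n from h, abs_neg, abs_of_pos hn0]
      · rw [show z.im = n from h, abs_of_pos hn0]
    refine h z ?_ (Or.inl (by linarith))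
    have := Complex.abs_im_le_norm z
    linarith
  · rcases hz.1 with h1 | h1
    · have h2 : z.re = x₀ - p := h1
      refine h z ?_ (Or.inr ⟨-n, by rw [h2, hp]; push_cast; ring⟩)
      have := Complex.abs_re_le_norm z
      rw [h2] at this
      have := neg_abs_le (x₀ - p)
      linarith
    · have h2 : z.re = x₀ + p := h1
      refine h z ?_ (Or.inr ⟨n, by rw [h2, hp]; push_cast; ring⟩)
      have := Complex.abs_re_le_norm z
      rw [h2] at this
      have := le_abs_self (x₀ + p)
      linarith

/-- Both functions differ from the common main term by `O(exp |Im ρ| / |ρ|)`, while the main term is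
at least of order `exp |Im ρ|` on the good set. So their quotient, which is entire, is bounded, and
Liouville's theorem applies. -/
theorem eq_of_analyticOrderAt_eq {γ : ℂ} (hγ : γ ≠ 0) {W₁ W₂ : ℝ → ℂ}
    (hW₁ : IntervalIntegrable W₁ volume 0 1) (hW₂ : IntervalIntegrable W₂ volume 0 1)
    {Δ₁ Δ₂ : ℂ → ℂ} (hΔ₁ : Differentiable ℂ Δ₁) (hΔ₂ : Differentiable ℂ Δ₂)
    (h₁ : ∀ ρ, Δ₁ (ρ ^ 2) = 1 + γ ^ 2 - 2 * γ * Complex.cos ρ - sinTransform W₁ ρ)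
    (h₂ : ∀ ρ, Δ₂ (ρ ^ 2) = 1 + γ ^ 2 - 2 * γ * Complex.cos ρ - sinTransform W₂ ρ)
    (hord : ∀ z, analyticOrderAt Δ₁ z = analyticOrderAt Δ₂ z) : Δ₁ = Δ₂ := by
  obtain ⟨x₀, c, Y, hc, hlow⟩ := exists_le_norm_sub_cos ((1 + γ ^ 2) / (2 * γ))
  set c' := ‖2 * γ‖ * c with hc'
  have hγ2 : 0 < ‖2 * γ‖ := norm_pos_iff.2 (by simpa using hγ)
  have hc'0 : 0 < c' := mul_pos hγ2 hc
  set good : ℂ → Prop := fun ρ => |ρ.im| ≥ Y ∨ ∃ k : ℤ, ρ.re = x₀ + k * (2 * Real.pi) with hgood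
  have hlow' : ∀ ρ, good ρ → c' * Real.exp |ρ.im| ≤ ‖1 + γ ^ 2 - 2 * γ * Complex.cos ρ‖ := by
    intro ρ hρ
    have e : 1 + γ ^ 2 - 2 * γ * Complex.cos ρ =
        2 * γ * ((1 + γ ^ 2) / (2 * γ) - Complex.cos ρ) := by field_simp
    rw [e, norm_mul, hc', mul_assoc]
    gcongr
    exact hlow ρ hρ
  set C := (∫ u in (0 : ℝ)..1, ‖W₁ u‖) + ∫ u in (0 : ℝ)..1, ‖W₂ u‖ with hC
  have n₁ : 0 ≤ ∫ u in (0 : ℝ)..1, ‖W₁ u‖ :=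
    intervalIntegral.integral_nonneg zero_le_one fun _ _ => norm_nonneg _
  have n₂ : 0 ≤ ∫ u in (0 : ℝ)..1, ‖W₂ u‖ :=
    intervalIntegral.integral_nonneg zero_le_one fun _ _ => norm_nonneg _
  have u₁ : ∀ ρ, ‖ρ‖ * ‖sinTransform W₁ ρ‖ ≤ C * Real.exp |ρ.im| := fun ρ => by
    rw [← norm_mul]
    refine (norm_mul_sinTransform_le hW₁ ρ).trans ?_
    gcongr; linarith
  have u₂ : ∀ ρ, ‖ρ‖ * ‖sinTransform W₂ ρ‖ ≤ C * Real.exp |ρ.im| := fun ρ => by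
    rw [← norm_mul]
    refine (norm_mul_sinTransform_le hW₂ ρ).trans ?_
    gcongr; linarith
  -- Beyond this radius each sine transform is at most half of the lower bound for the main term.
  set R := 2 * C / c' + 1 with hR
  have hCn : 0 ≤ C := add_nonneg n₁ n₂
  have small : ∀ (W : ℝ → ℂ) ρ, ‖ρ‖ * ‖sinTransform W ρ‖ ≤ C * Real.exp |ρ.im| → R ≤ ‖ρ‖ →
      ‖sinTransform W ρ‖ ≤ c' / 2 * Real.exp |ρ.im| := fun W ρ hu hρ => by
    have hE := Real.exp_pos |ρ.im|
    have hpos : 0 < ‖ρ‖ := lt_of_lt_of_le (by positivity) hρ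
    have h1 : C ≤ c' / 2 * ‖ρ‖ := by
      have : 2 * C / c' ≤ ‖ρ‖ := by linarith
      rw [div_le_iff₀ hc'0] at this
      linarith
    refine le_of_mul_le_mul_left ?_ hpos
    refine hu.trans ?_
    calc C * Real.exp |ρ.im| ≤ c' / 2 * ‖ρ‖ * Real.exp |ρ.im| := by gcongr
      _ = _ := by ring
  have hlow₂ : ∀ ρ, good ρ → R ≤ ‖ρ‖ → c' / 2 * Real.exp |ρ.im| ≤ ‖Δ₂ (ρ ^ 2)‖ := fun ρ hg hρ => by
    have h3 := norm_sub_norm_le (1 + γ ^ 2 - 2 * γ * Complex.cos ρ) (sinTransform W₂ ρ)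
    rw [← h₂] at h3
    linarith [hlow' ρ hg, small W₂ ρ (u₂ ρ) hρ]
  have hdiff : ∀ ρ, ‖ρ‖ * ‖Δ₁ (ρ ^ 2) - Δ₂ (ρ ^ 2)‖ ≤ 2 * C * Real.exp |ρ.im| := fun ρ => by
    rw [h₁, h₂, sub_sub_sub_cancel_left]
    have := mul_le_mul_of_nonneg_left (norm_sub_le (sinTransform W₂ ρ) (sinTransform W₁ ρ))
      (norm_nonneg ρ)
    linarith [u₁ ρ, u₂ ρ]
  -- points on the imaginary axis
  have himag : ∀ t : ℝ, 0 ≤ t → (t * Complex.I : ℂ).im = t ∧ ‖(t * Complex.I : ℂ)‖ = t :=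
    fun t ht => by simp [abs_of_nonneg ht]
  have himaggood : ∀ t : ℝ, |Y| + R ≤ t →
      0 ≤ t ∧ good (t * Complex.I) ∧ R ≤ ‖(t * Complex.I : ℂ)‖ := fun t ht => by
    have hR0 : 0 < R := by positivity
    have ht0 : 0 ≤ t := by linarith [abs_nonneg Y]
    refine ⟨ht0, Or.inl ?_, ?_⟩
    · rw [(himag t ht0).1, abs_of_nonneg ht0]; linarith [le_abs_self Y]
    · rw [(himag t ht0).2]; linarith [abs_nonneg Y]
  have hfin : ∀ z, analyticOrderAt Δ₂ z ≠ ⊤ := fun z htop => by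
    have hz : Δ₂ = 0 := (AnalyticOnNhd.analyticOrderAt_eq_top_iff_eq_zero z
      fun w => hΔ₂.analyticAt w).1 htop
    obtain ⟨-, hg, hR'⟩ := himaggood (|Y| + R) le_rfl
    have := hlow₂ _ hg hR'
    rw [hz, Pi.zero_apply, norm_zero] at this
    have : 0 < c' / 2 * Real.exp |((|Y| + R : ℝ) * Complex.I : ℂ).im| := by positivity
    linarith
  obtain ⟨h, hh, hmul⟩ := exists_differentiable_mul_eq hΔ₁ hΔ₂ hord hfin
  -- On the good set `‖Δ₁ - Δ₂‖ ≤ 2 ‖Δ₂‖`, whence the constant `3`.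
  have hbound : ∀ ρ, ‖h (ρ ^ 2)‖ ≤ 3 := by
    have hd : Differentiable ℂ fun ρ => h (ρ ^ 2) := hh.comp (by fun_prop)
    refine norm_le_of_rectangles hd (x₀ := x₀) (Y := Y) (R := max R 1) fun ρ hρ hg => ?_
    have hρR := (le_max_left _ _).trans hρ
    have l2 := hlow₂ ρ hg hρR
    have hE := Real.exp_pos |ρ.im|
    have hpos : 0 < ‖Δ₂ (ρ ^ 2)‖ := lt_of_lt_of_le (by positivity) l2
    have e1 : ‖Δ₁ (ρ ^ 2) - Δ₂ (ρ ^ 2)‖ ≤ c' * Real.exp |ρ.im| := by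
      rw [h₁, h₂, sub_sub_sub_cancel_left]
      refine (norm_sub_le _ _).trans ?_
      linarith [small W₁ ρ (u₁ ρ) hρR, small W₂ ρ (u₂ ρ) hρR]
    have e2 := norm_sub_norm_le (Δ₁ (ρ ^ 2)) (Δ₂ (ρ ^ 2))
    have e3 : ‖h (ρ ^ 2)‖ * ‖Δ₂ (ρ ^ 2)‖ ≤ 3 * ‖Δ₂ (ρ ^ 2)‖ := by
      rw [← norm_mul, ← hmul]; linarith
    exact le_of_mul_le_mul_right e3 hpos
  have hconst : ∀ z, h z = h 0 := fun z => by
    refine hh.apply_eq_apply_of_bounded ?_ z 0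
    refine (Metric.isBounded_closedBall (x := (0 : ℂ)) (r := 3)).subset ?_
    rintro _ ⟨z, rfl⟩
    obtain ⟨ρ, rfl⟩ := exists_sq_eq z
    simpa using hbound ρ
  have hone : h 0 - 1 = 0 := by
    by_contra hne
    have hpos : 0 < ‖h 0 - 1‖ := norm_pos_iff.2 hne
    have key : ∀ t : ℝ, |Y| + R ≤ t → t * ‖h 0 - 1‖ * (c' / 2) ≤ 2 * C := fun t ht => by
      obtain ⟨ht0, hg, hR'⟩ := himaggood t ht
      have hd := hdiff (t * Complex.I)
      have hl := hlow₂ _ hg hR'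
      rw [hmul, hconst, show h 0 * Δ₂ ((t * Complex.I) ^ 2) - Δ₂ ((t * Complex.I) ^ 2) =
        (h 0 - 1) * Δ₂ ((t * Complex.I) ^ 2) by ring, (himag t ht0).2, norm_mul] at hd
      have hE := Real.exp_pos |(t * Complex.I : ℂ).im|
      refine le_of_mul_le_mul_right ?_ hE
      refine le_trans ?_ hd
      calc t * ‖h 0 - 1‖ * (c' / 2) * Real.exp |(t * Complex.I : ℂ).im|
          = t * (‖h 0 - 1‖ * (c' / 2 * Real.exp |(t * Complex.I : ℂ).im|)) := by ring
        _ ≤ _ := by gcongr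
    have hp2 : 0 < ‖h 0 - 1‖ * (c' / 2) := by positivity
    -- This `t` is chosen so that the left side of `key` is at least `2 * C + 1`.
    have h1 := key (|Y| + R + (2 * C + 1) / (‖h 0 - 1‖ * (c' / 2))) (by
      have : 0 ≤ (2 * C + 1) / (‖h 0 - 1‖ * (c' / 2)) := by positivity
      linarith)
    rw [mul_assoc, add_mul, div_mul_cancel₀ _ hp2.ne'] at h1
    have h2 : 0 ≤ (|Y| + R) * (‖h 0 - 1‖ * (c' / 2)) := by positivity
    linarith
  funext z
  rw [hmul, hconst, sub_eq_zero.1 hone, one_mul]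

/-! ### Injectivity of the sine transform -/

/-- The Fourier coefficients of the odd extension to `(-1,1)` are multiples of `ρ` times the sine
transform at `ρ = πn`. They all vanish, and Parseval's identity finishes. -/
theorem ae_eq_zero_of_sinTransform_eq_zero {V : ℝ → ℂ} (hV : MemLp V 2 unitMeasure)
    (h : ∀ ρ, sinTransform V ρ = 0) : V =ᵐ[unitMeasure] 0 := by
  have hVi := intervalIntegrable_of_memLp_two hV
  rw [← memLp_indicator_iff_restrict measurableSet_Ioo] at hV
  set V' := (Ioo (0 : ℝ) 1).indicator V with hV'
  have hVn := hV.comp_measurePreserving (Measure.measurePreserving_neg volume)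
  set f : ℝ → ℂ := fun x => V' x - V' (-x) with hf
  have hfm : MemLp f 2 volume := hV.sub hVn
  have hlt : (-1 : ℝ) < 1 := by norm_num
  have hi : ∀ g : ℝ → ℂ, Continuous g → IntervalIntegrable (fun x => g x * V' x) volume (-1) 1 :=
    fun g hg => by
      have : IntervalIntegrable V' volume (-1) 1 := by
        rw [intervalIntegrable_iff_integrableOn_Ioc_of_le hlt.le]
        exact (hV.restrict (Ioc (-1) 1)).integrable one_le_two
      exact this.continuousOn_mul hg.continuousOn
  have hint : ∀ g : ℝ → ℂ, Continuous g →
      ∫ x in (-1 : ℝ)..1, g x * V' x = ∫ x in (0 : ℝ)..1, g x * V x := fun g hg => by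
    have e : (fun x => g x * V' x) = (Ioo (0 : ℝ) 1).indicator fun x => g x * V x := by
      funext x
      simp only [hV', indicator]
      split_ifs <;> simp
    rw [intervalIntegral.integral_of_le hlt.le, intervalIntegral.integral_of_le zero_le_one,
      e, setIntegral_indicator measurableSet_Ioo, integral_Ioc_eq_integral_Ioo,
      inter_eq_right.2 ((Ioo_subset_Ioo_left (by norm_num)).trans Ioo_subset_Ioc_self)]
  have hcoef : ∀ n, fourierCoeffOn hlt f n = 0 := fun n => by
    rw [fourierCoeffOn_eq_integral]
    set g : ℝ → ℂ := fun x => fourier (-n) (x : AddCircle ((1 : ℝ) - -1)) with hg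
    have hgc : Continuous g := (map_continuous _).comp (AddCircle.continuous_mk' _)
    have hgn : Continuous fun x => g (-x) := hgc.comp continuous_neg
    have hgs : ∀ x, g x - g (-x) = -2 * Complex.I * (Complex.sin (Real.pi * n * x)) := fun x => by
      simp only [hg, fourier_coe_apply, Complex.sin]
      push_cast
      ring_nf
      simp only [Complex.I_sq]
      ring_nf
    have e1 : ∫ x in (-1 : ℝ)..1, g x * V' (-x) = ∫ x in (-1 : ℝ)..1, g (-x) * V' x := by
      have := intervalIntegral.integral_comp_neg (a := -1) (b := 1) fun x => g (-x) * V' x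
      simpa using this
    have hin : IntervalIntegrable (fun x => g x * V' (-x)) volume (-1) 1 := by
      have := ((hi _ hgn).comp_sub_left 0).symm
      simpa using this
    have e2 : ∫ x in (-1 : ℝ)..1, g x • f x =
        -2 * Complex.I * ∫ x in (0 : ℝ)..1, V x * Complex.sin (Real.pi * n * x) := by
      simp only [smul_eq_mul, hf, mul_sub]
      rw [intervalIntegral.integral_sub (hi _ hgc) hin, e1, hint _ hgc, hint _ hgn,
        ← intervalIntegral.integral_sub (hVi.continuousOn_mul hgc.continuousOn)
          (hVi.continuousOn_mul hgn.continuousOn), ← intervalIntegral.integral_const_mul]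
      congr 1
      funext x
      rw [← sub_mul, hgs]
      ring
    have e3 := mul_sinTransform V (Real.pi * n)
    rw [h, mul_zero] at e3
    rw [e2, ← e3, mul_zero, smul_zero]
  have hz := (hasSum_sq_fourierCoeffOn hlt (hfm.restrict _)).tsum_eq
  simp only [hcoef, norm_zero, ne_eq, OfNat.ofNat_ne_zero, not_false_eq_true, zero_pow,
    tsum_zero] at hz
  have hz0 : ∫ x in Ioc (-1 : ℝ) 1, ‖f x‖ ^ 2 = 0 := by
    rw [intervalIntegral.integral_of_le hlt.le, smul_eq_mul] at hz
    norm_num at hz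
    exact hz
  have hfi : Integrable (fun x => ‖f x‖ ^ 2) (volume.restrict (Ioc (-1 : ℝ) 1)) :=
    (memLp_two_iff_integrable_sq_norm (hfm.restrict _).1).1 (hfm.restrict _)
  rw [integral_eq_zero_iff_of_nonneg (fun x => by positivity) hfi] at hz0
  have hz1 := ae_restrict_of_ae_restrict_of_subset
    (fun x (hx : x ∈ Ioo (0 : ℝ) 1) => (⟨by linarith [hx.1], hx.2.le⟩ : x ∈ Ioc (-1 : ℝ) 1)) hz0
  filter_upwards [hz1, ae_restrict_mem measurableSet_Ioo] with x hx hx1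
  have hxn : -x ∉ Ioo (0 : ℝ) 1 := fun h => by linarith [h.1, hx1.1]
  simpa [hf, hV', hx1, hxn] using hx

theorem ae_eq_of_sinTransform_eq {V₁ V₂ : ℝ → ℂ} (h₁ : MemLp V₁ 2 unitMeasure)
    (h₂ : MemLp V₂ 2 unitMeasure) (h : ∀ ρ, sinTransform V₁ ρ = sinTransform V₂ ρ) :
    V₁ =ᵐ[unitMeasure] V₂ := by
  have hz : V₁ - V₂ =ᵐ[unitMeasure] 0 := by
    refine ae_eq_zero_of_sinTransform_eq_zero (h₁.sub h₂) fun ρ => ?_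
    rw [← sub_eq_zero.2 (h ρ), sinTransform, sinTransform, sinTransform,
      ← intervalIntegral.integral_sub
        ((intervalIntegrable_of_memLp_two h₁).mul_continuousOn (by fun_prop))
        ((intervalIntegrable_of_memLp_two h₂).mul_continuousOn (by fun_prop))]
    simp only [Pi.sub_apply, sub_mul]
  filter_upwards [hz] with u hu using sub_eq_zero.1 hu

/-! ### Uniqueness for `γ ≠ ±1` -/

theorem IsSpectrum.unique {γ : ℂ} {a : ℝ} (hγ : γ ≠ 0) (h1 : γ ≠ 1) (h2 : γ ≠ -1)
    (ha : a ∈ Icc (0 : ℝ) 1) {lam : ℕ → ℂ} {q₁ q₂ : L2} (hq₁ : IsSpectrum q₁ a γ lam)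
    (hq₂ : IsSpectrum q₂ a γ lam) : q₁ = q₂ := by
  have hX : ∀ q : L2, MemLp (unfoldAt a γ q) 2 unitMeasure := fun q =>
    memLp_unfoldAt ha γ (Lp.memLp q)
  set W : L2 → ℝ → ℂ := fun q u => unfoldAt a γ q u + γ * unfoldAt a γ q (1 - u) with hW
  have hWm : ∀ q, MemLp (W q) 2 unitMeasure := fun q =>
    (hX q).add ((memLp_comp_one_sub (hX q)).const_mul γ)
  have hWi := fun q => intervalIntegrable_of_memLp_two (hWm q)
  obtain ⟨Δ₁, hΔ₁, heq₁⟩ := exists_entire_charFunction γ (hWi q₁)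
  obtain ⟨Δ₂, hΔ₂, heq₂⟩ := exists_entire_charFunction γ (hWi q₂)
  have hdet : ∀ (q : L2) (ρ : ℂ), charDet q a γ ρ =
      1 + γ ^ 2 - 2 * γ * Complex.cos ρ - sinTransform (W q) ρ := fun q ρ =>
    charDet_eq_sinTransform ha (X := unfoldAt a γ q) EventuallyEq.rfl (Eventually.of_forall fun _ => rfl) ρ
  have hΔ : Δ₁ = Δ₂ := eq_of_analyticOrderAt_eq hγ (hWi q₁) (hWi q₂) hΔ₁ hΔ₂ heq₁ heq₂ fun z => by
    rw [hq₁.analyticOrderAt_eq ha hΔ₁ (fun ρ => by rw [heq₁, hdet]),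
      hq₂.analyticOrderAt_eq ha hΔ₂ (fun ρ => by rw [heq₂, hdet])]
  have hWe : W q₁ =ᵐ[unitMeasure] W q₂ := ae_eq_of_sinTransform_eq (hWm q₁) (hWm q₂) fun ρ =>
    sub_right_injective (((heq₁ ρ).symm.trans (congrFun hΔ _)).trans (heq₂ ρ))
  refine eq_of_unfoldAt_eq ha hγ ?_
  have hne : (1 - γ) * (1 + γ) ≠ 0 := mul_ne_zero (sub_ne_zero.2 h1.symm)
    fun h => h2 (eq_neg_of_add_eq_zero_right h)
  filter_upwards [hWe, ae_comp_one_sub hWe] with u hu hu'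
  simp only [hW, sub_sub_cancel] at hu hu'
  -- The equation at `u` minus `γ` times the equation at `1 - u` isolates `(1 - γ²)X(u)`.
  exact mul_left_cancel₀ hne (by linear_combination hu - γ * hu')

end FrozenHill

end

theorem theorem3 (γ α : ℂ) (a : ℝ) (hγ : γ ≠ 0) (ha : a ∈ Set.Icc (0 : ℝ) 1)
    (hα : FrozenHill.IsShift γ α) :
    (γ ≠ 1 → γ ≠ -1 → ∀ lam κ : ℕ → ℂ, FrozenHill.HasAsymptotics α lam κ →
      ∃! q : FrozenHill.L2, FrozenHill.IsSpectrum q a γ lam) ∧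
    (γ = 1 ∨ γ = -1 → ∀ lam κ : ℕ → ℂ, FrozenHill.HasAsymptotics α lam κ →
      (∀ k : ℕ, 1 ≤ k → κ (2 * k - 1) = 0) →
      ∃ q₁ q₂ : FrozenHill.L2, q₁ ≠ q₂ ∧
        FrozenHill.IsSpectrum q₁ a γ lam ∧ FrozenHill.IsSpectrum q₂ a γ lam) := by
  refine ⟨fun h1 h2 lam κ h => ?_, fun h1 lam κ h hκ =>
    FrozenHill.exists_ne_isSpectrum h1 ha hα h hκ⟩
  obtain ⟨q, hq⟩ := FrozenHill.exists_isSpectrum hγ h1 h2 ha hα h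
  exact ⟨q, hq, fun q' hq' => FrozenHill.IsSpectrum.unique hγ h1 h2 ha hq' hq⟩
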